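/- Let $\gamma,\beta\in\mathbb R\setminus\{0\}$ and consider on $\mathbb T=\mathbb R/2\pi\mathbb Z$ the stochastic damped sine-Gordon equation $$\partial_t^2u+\partial_tu+(1-\partial_x^2)u+\gamma\sin(\beta u)=\sqrt2\,\xi,\qquad (u,\partial_tu)|_{t=0}=\mathbf u_0 ,$$ where $\xi=\partial_tW$ is a space-time white noise, $W(t)=\sum_{n\in\mathbb Z}B_n(t)e^{inx}$ being a cylindrical Wiener process on the real space $L^2(\mathbb T)$ ($\mathbb T$ with normalized Lebesgue measure): $B_{-n}=\overline{B_n}$ and, up to this constraint, the $B_n$ are independent Brownian motions, $B_0$ real and $B_n$ complex for $n\neq0$, with $\mathbb E|B_n(t)|^2=t$. For $\alpha\in\mathbb R$ let $\mathcal H^\alpha=H^\alpha(\mathbb T)\times H^{\alpha-1}(\mathbb T)$ (real-valued distributions). Fix $0\le s<\frac12$ and take $\mathcal H^s$ as phase space. Then, almost surely, for every $\mathbf u_0\in\mathcal H^s$ there is a unique global mild solution $t\mapsto\vec\Phi_t(\mathbf u_0,\xi)=(u(t),\partial_tu(t))$ in $C(\mathbb R_+;\mathcal H^s)$, that is, $$u(t)=S(t)\mathbf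 u_0+\sqrt2\int_0^t\mathcal D(t-r)\,dW(r)-\gamma\int_0^t\mathcal D(t-r)\sin(\beta u(r))\,dr,$$ together with the corresponding formula for $\partial_tu$, where $\mathcal D(t)=e^{-t/2}\frac{\sin(t\sqrt{3/4-\partial_x^2})}{\sqrt{3/4-\partial_x^2}}$ and $S(t)(f,g)=\partial_t\mathcal D(t)f+\mathcal D(t)(f+g)$. Put $P_tF(\mathbf u_0)=\mathbb E[F(\vec\Phi_t(\mathbf u_0,\xi))]$ for bounded measurable $F:\mathcal H^s\to\mathbb R$. Let $F:\mathcal H^s\to\{0,1\}$ be the indicator function of $\mathcal H^\sigma$ for some $s<\sigma<\frac12$, or of $\bigcap_{\sigma<1/2}\mathcal H^\sigma$. Then $F$ is bounded and Borel measurable, and for every $t\ge0$ $$P_tF(\mathbf u_0)=F(\mathbf u_0)\qquad\text{for all }\mathbf u_0\in\mathcal H^s .$$ Consequently $P_tF$ is a discontinuous function on $\mathcal H^s$, and for no $t\ge0$ does $P_t$ have the strong Feller property (i.e. $P_t$ does not map all bounded measurable functions on $\mathcal H^s$ to continuous functions). -/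

import Mathlib

open MeasureTheory ProbabilityTheory
open scoped NNReal Real ComplexConjugate

namespace SineGordon

noncomputable section

/-! ### Sobolev spaces of real distributions on the circle `ℝ / 2πℤ`

A distribution on the circle is represented by its sequence of Fourier coefficients. -/

/-- The sequence of Fourier coefficients `a` satisfies `∑ ⟨n⟩^{2s} |a n|² < ∞`,
where `⟨n⟩ = (1 + n²)^{1/2}`. -/
def MemH (s : ℝ) (a : ℤ → ℂ) : Prop :=
  Summable fun n : ℤ => (1 + (n : ℝ) ^ 2) ^ s * ‖a n‖ ^ 2

theorem MemH.memℓp {s : ℝ} {a : ℤ → ℂ} (h : MemH s a) :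
    Memℓp (fun n : ℤ => (((1 + (n : ℝ) ^ 2) ^ (s / 2) : ℝ) : ℂ) * a n) 2 := by
  refine memℓp_gen ?_
  refine h.congr fun n => ?_
  have hp : (0 : ℝ) ≤ 1 + (n : ℝ) ^ 2 := by positivity
  have h2 : ((1 + (n : ℝ) ^ 2) ^ (s / 2)) ^ 2 = (1 + (n : ℝ) ^ 2) ^ s := by
    rw [← Real.rpow_natCast, ← Real.rpow_mul hp]
    congr 1
    push_cast
    ring
  have h3 : ‖(((1 + (n : ℝ) ^ 2) ^ (s / 2) : ℝ) : ℂ)‖ = (1 + (n : ℝ) ^ 2) ^ (s / 2) := by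
    rw [Complex.norm_real, Real.norm_of_nonneg (Real.rpow_nonneg hp _)]
  simp only [ENNReal.toReal_ofNat, Real.rpow_ofNat, norm_mul, mul_pow, h3, h2]

theorem MemH.of_memℓp {s : ℝ} {a : ℤ → ℂ}
    (h : Memℓp (fun n : ℤ => (((1 + (n : ℝ) ^ 2) ^ (s / 2) : ℝ) : ℂ) * a n) 2) : MemH s a := by
  refine (h.summable (by norm_num)).congr fun n => ?_
  have hp : (0 : ℝ) ≤ 1 + (n : ℝ) ^ 2 := by positivity
  have h2 : ((1 + (n : ℝ) ^ 2) ^ (s / 2)) ^ 2 = (1 + (n : ℝ) ^ 2) ^ s := by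
    rw [← Real.rpow_natCast, ← Real.rpow_mul hp]
    congr 1
    push_cast
    ring
  have h3 : ‖(((1 + (n : ℝ) ^ 2) ^ (s / 2) : ℝ) : ℂ)‖ = (1 + (n : ℝ) ^ 2) ^ (s / 2) := by
    rw [Complex.norm_real, Real.norm_of_nonneg (Real.rpow_nonneg hp _)]
  simp only [ENNReal.toReal_ofNat, Real.rpow_ofNat, norm_mul, mul_pow, h3, h2]

/-- The coefficient sequences of the real-valued elements of `H^s`. -/
def sobolevSubmodule (s : ℝ) : Submodule ℝ (ℤ → ℂ) where
  carrier := {a | MemH s a ∧ ∀ n, a (-n) = conj (a n)}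
  zero_mem' := by
    refine ⟨?_, fun n => by simp⟩
    simp [MemH]
  add_mem' := by
    rintro a b ⟨ha, ha'⟩ ⟨hb, hb'⟩
    refine ⟨MemH.of_memℓp ?_, fun n => by simp [ha', hb']⟩
    have h := ha.memℓp.add hb.memℓp
    convert h using 1
    funext n
    simp [mul_add]
  smul_mem' := by
    rintro c a ⟨ha, ha'⟩
    refine ⟨?_, fun n => by simp [ha']⟩
    refine (Summable.mul_left (c ^ 2) ha).congr fun n => ?_
    simp only [Pi.smul_apply, norm_smul, Real.norm_eq_abs, mul_pow, sq_abs]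
    ring

/-- The space `H^s` of real-valued distributions on the circle `ℝ / 2πℤ`. -/
def Sobolev (s : ℝ) : Type := sobolevSubmodule s

namespace Sobolev

variable {s : ℝ}

instance : AddCommGroup (Sobolev s) := inferInstanceAs (AddCommGroup (sobolevSubmodule s))

instance : Module ℝ (Sobolev s) := inferInstanceAs (Module ℝ (sobolevSubmodule s))

/-- The Fourier coefficients of an element of `H^s`. -/
def coeff (u : Sobolev s) : ℤ → ℂ := u.1

/-- The embedding of `H^s` into `ℓ²(ℤ)`, `û ↦ (⟨n⟩^s û(n))_n`, which defines the norm of `H^s`. -/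
def toEll2 (s : ℝ) : Sobolev s →ₗ[ℝ] lp (fun _ : ℤ => ℂ) 2 where
  toFun u := ⟨fun n => (((1 + (n : ℝ) ^ 2) ^ (s / 2) : ℝ) : ℂ) * u.coeff n, u.2.1.memℓp⟩
  map_add' u v := by
    ext n
    exact mul_add _ (u.coeff n) (v.coeff n)
  map_smul' c u := by
    ext n
    change _ * (c • u.coeff n) = c • (_ * u.coeff n)
    rw [mul_smul_comm]

theorem toEll2_injective (s : ℝ) : Function.Injective (toEll2 s) := by
  intro u v h
  refine Subtype.ext (funext fun n => ?_)
  have hn : (((1 + (n : ℝ) ^ 2) ^ (s / 2) : ℝ) : ℂ) * u.coeff n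
      = (((1 + (n : ℝ) ^ 2) ^ (s / 2) : ℝ) : ℂ) * v.coeff n :=
    congrFun (congrArg Subtype.val h) n
  have h0 : (((1 + (n : ℝ) ^ 2) ^ (s / 2) : ℝ) : ℂ) ≠ 0 := by
    have : (0 : ℝ) < 1 + (n : ℝ) ^ 2 := by positivity
    exact_mod_cast (Real.rpow_pos_of_pos this _).ne'
  exact mul_left_cancel₀ h0 hn

/-- The norm `‖u‖² = ∑ ⟨n⟩^{2s} |û(n)|²`. -/
instance : NormedAddCommGroup (Sobolev s) :=
  NormedAddCommGroup.induced (Sobolev s) (lp (fun _ : ℤ => ℂ) 2) (toEll2 s) (toEll2_injective s)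

instance : NormedSpace ℝ (Sobolev s) :=
  NormedSpace.induced ℝ (Sobolev s) (lp (fun _ : ℤ => ℂ) 2) (toEll2 s)

instance : MeasurableSpace (Sobolev s) := borel _

instance : BorelSpace (Sobolev s) := ⟨rfl⟩

end Sobolev

/-- The space `𝓗^s = H^s × H^{s-1}` of pairs (position, velocity). -/
abbrev Phase (s : ℝ) : Type := Sobolev s × Sobolev (s - 1)

/-- An element of some `𝓗^s` belongs to `𝓗^σ`. -/
def InPhase {s : ℝ} (σ : ℝ) (u : Phase s) : Prop :=
  MemH σ u.1.coeff ∧ MemH (σ - 1) u.2.coeff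

open Classical in
/-- The indicator function of `𝓗^σ`, as a function on `𝓗^s`. -/
def indicatorPhase (s σ : ℝ) (u : Phase s) : ℝ := if InPhase σ u then 1 else 0

open Classical in
/-- The indicator function of `⋂_{σ < 1/2} 𝓗^σ`, as a function on `𝓗^s`. -/
def indicatorPhaseHalfMinus (s : ℝ) (u : Phase s) : ℝ :=
  if ∀ σ < (1 / 2 : ℝ), InPhase σ u then 1 else 0

/-! ### The noise -/

/-- The real components of a sequence of complex processes: `Re W₀`, and `√2 Re Wₖ`, `√2 Im Wₖ`
for `k ≥ 1` (the latter has index `-k`). -/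
def realComponent {Ω : Type*} (W : ℤ → ℝ≥0 → Ω → ℂ) (k : ℤ) (t : ℝ≥0) (ω : Ω) : ℝ :=
  if k = 0 then (W 0 t ω).re
  else if 0 < k then √2 * (W k t ω).re
  else √2 * (W (-k) t ω).im

/-- `W = ∑ₙ Wₙ e^{inx}` is a cylindrical Wiener process on the real `L²(ℝ / 2πℤ)` (with normalized
Lebesgue measure): `W₋ₙ` is the conjugate of `Wₙ`, and, up to this constraint, the `Wₙ` are
independent Brownian motions, `W₀` a real and `Wₙ`, `n ≠ 0`, a complex one, with
`𝔼|Wₙ(t)|² = t`. Its time derivative is a space-time white noise. -/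
structure IsCylindricalWiener {Ω : Type*} [MeasurableSpace Ω] (W : ℤ → ℝ≥0 → Ω → ℂ)
    (P : Measure Ω) : Prop where
  conj_symm : ∀ n t ω, W (-n) t ω = conj (W n t ω)
  isBrownian : ∀ k, IsBrownianReal (realComponent W k) P
  indep : iIndepFun (fun k ω t => realComponent W k t ω) P

/-! ### The linear damped wave equation -/

/-- The Fourier multiplier `e^{-t/2} sin(t √(3/4 + n²)) / √(3/4 + n²)` of the linear damped wave
propagator. -/
def propagator (n : ℤ) (t : ℝ) : ℝ :=
  Real.exp (-t / 2) * (Real.sin (t * √(3 / 4 + (n : ℝ) ^ 2)) / √(3 / 4 + (n : ℝ) ^ 2))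

/-- First time derivative of the propagator. -/
def propagator' (n : ℤ) : ℝ → ℝ := deriv (propagator n)

/-- Second time derivative of the propagator. -/
def propagator'' (n : ℤ) : ℝ → ℝ := deriv (propagator' n)

/-- The `n`-th Fourier coefficient of `S(t)(f, g) = ∂ₜD(t) f + D(t) (f + g)`. -/
def linearPosition (n : ℤ) (t : ℝ) (f g : ℂ) : ℂ :=
  propagator' n t * f + propagator n t * (f + g)

/-- The `n`-th Fourier coefficient of `∂ₜS(t)(f, g)`. -/
def linearVelocity (n : ℤ) (t : ℝ) (f g : ℂ) : ℂ :=
  propagator'' n t * f + propagator' n t * (f + g)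

/-- The Wiener integral `∫₀ᵗ f(r) dw(r)` of a `C¹` function `f` along a continuous path `w`, which is
a Riemann-Stieltjes integral, evaluated by integration by parts. -/
def wienerIntegral (f : ℝ → ℝ) (w : ℝ≥0 → ℂ) (t : ℝ≥0) : ℂ :=
  f t * w t - f 0 * w 0 - ∫ r in (0 : ℝ)..t, ((deriv f r : ℝ) : ℂ) * w r.toNNReal

/-- The `n`-th Fourier coefficient of the stochastic convolution `√2 ∫₀ᵗ D(t - r) dW(r)`. -/
def stochConv (w : ℤ → ℝ≥0 → ℂ) (n : ℤ) (t : ℝ≥0) : ℂ :=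
  √2 * wienerIntegral (fun r => propagator n (t - r)) (w n) t

/-- The `n`-th Fourier coefficient of the time derivative `√2 ∫₀ᵗ ∂ₜD(t - r) dW(r)` of the stochastic
convolution (recall `D(0) = 0`). -/
def stochConvVelocity (w : ℤ → ℝ≥0 → ℂ) (n : ℤ) (t : ℝ≥0) : ℂ :=
  √2 * wienerIntegral (fun r => propagator' n (t - r)) (w n) t

/-! ### The stochastic sine-Gordon equation -/

instance : Fact (0 < 2 * π) := ⟨Real.two_pi_pos⟩

open Classical in
/-- The real function `∑ₙ aₙ e^{inx}` in `L²` with Fourier coefficients `a` (for `a` in `ℓ²`). -/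
def realize (a : ℤ → ℂ) (x : AddCircle (2 * π)) : ℝ :=
  if h : Memℓp a 2 then
    ((fourierBasis (T := 2 * π)).repr.symm ⟨a, h⟩ x).re
  else 0

/-- The Fourier coefficients of `sin(β u)`, where `a` are those of `u`. -/
def sinCoeff (β : ℝ) (a : ℤ → ℂ) (n : ℤ) : ℂ :=
  fourierCoeff (fun x : AddCircle (2 * π) => ((Real.sin (β * realize a x) : ℝ) : ℂ)) n

/-- `Φ = (u, ∂ₜu)` is a (global, continuous) mild solution with initial datum `u₀` of
`∂ₜ²u + ∂ₜu + (1 - ∂ₓ²)u + γ sin(βu) = √2 ξ` for the realization `w` of the noise, i.e.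
`u(t) = S(t)u₀ + √2 ∫₀ᵗ D(t - r) dW(r) - γ ∫₀ᵗ D(t - r) sin(βu(r)) dr` for all `t ≥ 0`, with the
corresponding formula for the time derivative. -/
structure IsMildSolution (γ β : ℝ) {s : ℝ} (w : ℤ → ℝ≥0 → ℂ) (u₀ : Phase s)
    (Φ : C(ℝ≥0, Phase s)) : Prop where
  position : ∀ (t : ℝ≥0) (n : ℤ), (Φ t).1.coeff n =
    linearPosition n t (u₀.1.coeff n) (u₀.2.coeff n) + stochConv w n t
      - γ * ∫ r in (0 : ℝ)..t, (propagator n (t - r) : ℂ) * sinCoeff β (Φ r.toNNReal).1.coeff n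
  velocity : ∀ (t : ℝ≥0) (n : ℤ), (Φ t).2.coeff n =
    linearVelocity n t (u₀.1.coeff n) (u₀.2.coeff n) + stochConvVelocity w n t
      - γ * ∫ r in (0 : ℝ)..t, (propagator' n (t - r) : ℂ) * sinCoeff β (Φ r.toNNReal).1.coeff n

open Classical in
/-- The flow `Φₜ(u₀, w)`: the value at time `t` of the mild solution (`0` if there is none). -/
def flow (γ β s : ℝ) (w : ℤ → ℝ≥0 → ℂ) (u₀ : Phase s) (t : ℝ≥0) : Phase s :=
  if h : ∃ Φ : C(ℝ≥0, Phase s), IsMildSolution γ β w u₀ Φ then h.choose t else 0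

/-- The transition operator `PₜF(u₀) = 𝔼[F(Φₜ(u₀, ξ))]`. -/
def transition {Ω : Type*} [MeasurableSpace Ω] (P : Measure Ω) (W : ℤ → ℝ≥0 → Ω → ℂ)
    (γ β s : ℝ) (t : ℝ≥0) (F : Phase s → ℝ) (u₀ : Phase s) : ℝ :=
  ∫ ω, F (flow γ β s (fun n r => W n r ω) u₀ t) ∂P

/-- An operator on functions has the strong Feller property if it maps bounded measurable functions
to continuous functions. -/
def IsStrongFeller {X : Type*} [TopologicalSpace X] [MeasurableSpace X]
    (T : (X → ℝ) → X → ℝ) : Prop :=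
  ∀ F : X → ℝ, Measurable F → (∃ C, ∀ x, |F x| ≤ C) → Continuous (T F)

end

end SineGordon

namespace SineGordon

/-! The mild formula writes the solution as `S(t)u₀` plus two terms. Almost surely both of these lie
in `𝓗^σ` for every `σ < 1/2`, at all times and for all initial data. The Duhamel term is in `H^1 ×
L²` because `sin(βu)` is bounded, hence bounded in `L²`, and the propagator gains one derivative
(`isPhasePath_duhamel`). The stochastic convolution is in `𝓗^σ` for all `σ < 1/2` by a maximal
inequality for each mode (`IsCylindricalWiener.ae_isRegularNoise`, `IsRegularNoise.isPhasePath`).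
The linear flow acts on each Fourier mode as an invertible matrix, bounded together with its inverse
uniformly in the mode for the energy norm, so it neither creates nor destroys regularity
(`memH_linear_iff`).

Hence `Φ_t(u₀)` belongs to `𝓗^σ` exactly when `u₀` does (`IsRegularNoise.inPhase_flow_iff`). The
indicators in question are almost surely constant along the flow, and `P_t F = F`. Each indicator is
that of a proper linear subspace: it is `1` at the origin and `0` on a punctured line through the
origin, so it is discontinuous (`exists_not_inPhase`, `not_continuous_of_smul`). This excludes the
strong Feller property at every time.

Well-posedness is a Volterra contraction for the position in `ℓ²` with an exponential time weight
(`existsUnique_volterra`, `existsUnique_mild`). For the noise, the addition formulas take the time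
`t` out of the integrand. What remains are Wiener integrals of fixed bounded functions, to which
Doob's inequality applies; it is proved for Riemann sums and passed to the limit by Fatou. The
resulting bounds are uniform in `n`, and `∑ ⟨n⟩^{2(σ-1)}` converges for `σ < 1/2`. -/

/-! ### The propagator -/

/-- The frequency `√(3/4 + n²)` of the `n`-th mode. -/
noncomputable def freq (n : ℤ) : ℝ := √(3 / 4 + (n : ℝ) ^ 2)

theorem freq_sq (n : ℤ) : freq n ^ 2 = 3 / 4 + (n : ℝ) ^ 2 :=
  Real.sq_sqrt (by positivity)

theorem freq_pos (n : ℤ) : 0 < freq n :=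
  Real.sqrt_pos.2 (by positivity)

theorem propagator_eq (n : ℤ) (t : ℝ) :
    propagator n t = Real.exp (-t / 2) * (Real.sin (t * freq n) / freq n) := rfl

theorem hasDerivAt_exp_neg_half (t : ℝ) :
    HasDerivAt (fun t : ℝ => Real.exp (-t / 2)) (-(Real.exp (-t / 2) / 2)) t := by
  have h := ((hasDerivAt_id t).neg.div_const 2).exp
  simp only [Pi.neg_apply, id] at h
  exact h.congr_deriv (by ring)

theorem hasDerivAt_propagator (n : ℤ) (t : ℝ) :
    HasDerivAt (propagator n)
      (Real.exp (-t / 2) * (Real.cos (t * freq n) - Real.sin (t * freq n) / (2 * freq n))) t := by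
  have h0 := (freq_pos n).ne'
  have h := (hasDerivAt_exp_neg_half t).mul
    (((hasDerivAt_mul_const (freq n) (x := t)).sin).div_const (freq n))
  exact h.congr_deriv (by field_simp; ring)

theorem propagator'_eq (n : ℤ) (t : ℝ) : propagator' n t =
    Real.exp (-t / 2) * (Real.cos (t * freq n) - Real.sin (t * freq n) / (2 * freq n)) :=
  (hasDerivAt_propagator n t).deriv

/-- The damped oscillator equation `D'' + D' + ⟨n⟩² D = 0`; the damping `1/2` and the frequency
combine through `freq n ^ 2 + 1/4 = 1 + n²`. -/
theorem hasDerivAt_propagator' (n : ℤ) (t : ℝ) :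
    HasDerivAt (propagator' n)
      (-propagator' n t - (1 + (n : ℝ) ^ 2) * propagator n t) t := by
  have h0 := (freq_pos n).ne'
  have h1 := hasDerivAt_mul_const (freq n) (x := t)
  have h := (hasDerivAt_exp_neg_half t).mul (h1.cos.sub (h1.sin.div_const (2 * freq n)))
  have he : propagator' n = _ := funext (propagator'_eq n)
  rw [he]
  refine h.congr_deriv ?_
  have h2 : 1 + (n : ℝ) ^ 2 = freq n ^ 2 + 1 / 4 := by rw [freq_sq]; ring
  simp only [propagator_eq, h2, Pi.sub_apply]
  field_simp
  ring

theorem propagator''_eq (n : ℤ) (t : ℝ) :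
    propagator'' n t = -propagator' n t - (1 + (n : ℝ) ^ 2) * propagator n t :=
  (hasDerivAt_propagator' n t).deriv

theorem continuous_propagator (n : ℤ) : Continuous (propagator n) :=
  continuous_iff_continuousAt.2 fun t => (hasDerivAt_propagator n t).continuousAt

theorem continuous_propagator' (n : ℤ) : Continuous (propagator' n) :=
  continuous_iff_continuousAt.2 fun t => (hasDerivAt_propagator' n t).continuousAt

theorem propagator_neg (n : ℤ) : propagator (-n) = propagator n := by
  funext t
  simp [propagator]

theorem propagator'_neg (n : ℤ) : propagator' (-n) = propagator' n := by
  simp [propagator', propagator_neg]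

/-- The Wronskian identity of the damped oscillator. -/
theorem propagator_wronskian (n : ℤ) (t : ℝ) :
    propagator' n t ^ 2 + propagator n t * propagator' n t
      + (1 + (n : ℝ) ^ 2) * propagator n t ^ 2 = Real.exp (-t) := by
  have h0 := (freq_pos n).ne'
  have h2 : 1 + (n : ℝ) ^ 2 = freq n ^ 2 + 1 / 4 := by rw [freq_sq]; ring
  have he : Real.exp (-t) = Real.exp (-t / 2) ^ 2 := by
    rw [← Real.exp_nat_mul]
    congr 1
    push_cast
    ring
  rw [propagator_eq, propagator'_eq, h2, he]
  have hs := Real.sin_sq_add_cos_sq (t * freq n)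
  field_simp
  linear_combination (16 * freq n ^ 2) * hs

/-- The linear flow is dissipative up to a constant. -/
theorem propagator_energy_le (n : ℤ) {t : ℝ} (ht : 0 ≤ t) :
    propagator' n t ^ 2 + (1 + (n : ℝ) ^ 2) * propagator n t ^ 2 ≤ 2 := by
  have h := propagator_wronskian n t
  have h1 : Real.exp (-t) ≤ 1 := Real.exp_le_one_iff.2 (by linarith)
  -- Twice the Wronskian form minus the energy equals `(D' + D)² + n² D² ≥ 0`, so the energy is at
  -- most `2 e^{-t}`.
  nlinarith [sq_nonneg (propagator' n t + propagator n t), sq_nonneg ((n : ℝ) * propagator n t)]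

theorem abs_propagator'_le (n : ℤ) {t : ℝ} (ht : 0 ≤ t) : |propagator' n t| ≤ 2 := by
  refine abs_le_of_sq_le_sq ?_ (by norm_num)
  nlinarith [propagator_energy_le n ht,
    mul_nonneg (by positivity : 0 ≤ 1 + (n : ℝ) ^ 2) (sq_nonneg (propagator n t))]

theorem abs_propagator_le (n : ℤ) {t : ℝ} (ht : 0 ≤ t) :
    √(1 + (n : ℝ) ^ 2) * |propagator n t| ≤ 2 := by
  refine (sq_le_sq₀ (by positivity) (by norm_num)).1 ?_
  rw [mul_pow, Real.sq_sqrt (by positivity), sq_abs]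
  nlinarith [propagator_energy_le n ht, sq_nonneg (propagator' n t)]

theorem abs_propagator_le_two (n : ℤ) {t : ℝ} (ht : 0 ≤ t) : |propagator n t| ≤ 2 := by
  refine le_trans ?_ (abs_propagator_le n ht)
  refine le_mul_of_one_le_left (abs_nonneg _) ?_
  exact Real.one_le_sqrt.2 (by nlinarith [sq_nonneg (n : ℝ)])

/-! ### The energy of a mode -/

/-- The energy `⟨n⟩²|a|² + |b|²` of the `n`-th mode with position `a` and velocity `b`. -/
noncomputable def energy (n : ℤ) (a b : ℂ) : ℝ := (1 + (n : ℝ) ^ 2) * ‖a‖ ^ 2 + ‖b‖ ^ 2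

theorem energy_nonneg (n : ℤ) (a b : ℂ) : 0 ≤ energy n a b := by
  unfold energy; positivity

theorem norm_add_sq_le_two (a b : ℂ) : ‖a + b‖ ^ 2 ≤ 2 * (‖a‖ ^ 2 + ‖b‖ ^ 2) := by
  have h := norm_add_le a b
  nlinarith [sq_nonneg (‖a‖ - ‖b‖), norm_nonneg (a + b), norm_nonneg a, norm_nonneg b]

theorem energy_add_le (n : ℤ) (a a' b b' : ℂ) :
    energy n (a + a') (b + b') ≤ 2 * (energy n a b + energy n a' b') := by
  unfold energy
  have h0 : 0 ≤ 1 + (n : ℝ) ^ 2 := by positivity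
  nlinarith [norm_add_sq_le_two a a', norm_add_sq_le_two b b',
    mul_le_mul_of_nonneg_left (norm_add_sq_le_two a a') h0]

theorem energy_mul (n : ℤ) (c a b : ℂ) :
    energy n (c * a) (c * b) = ‖c‖ ^ 2 * energy n a b := by
  simp only [energy, norm_mul, mul_pow]
  ring

/-- Energy bound for a two by two matrix with entries of the size of those of the propagator. -/
theorem energy_matrix_le (n : ℤ) {C x y z w : ℝ} (f g : ℂ)
    (hx : x ^ 2 ≤ C) (hy : (1 + (n : ℝ) ^ 2) * y ^ 2 ≤ C)
    (hz : z ^ 2 ≤ C * (1 + (n : ℝ) ^ 2)) (hw : w ^ 2 ≤ C) :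
    energy n (x * f + y * g) (z * f + w * g) ≤ 4 * C * energy n f g := by
  have e1 := norm_add_sq_le_two (x * f) (y * g)
  have e2 := norm_add_sq_le_two (z * f) (w * g)
  simp only [norm_mul, Complex.norm_real, mul_pow, Real.norm_eq_abs, sq_abs] at e1 e2
  unfold energy
  have h0 : 0 ≤ 1 + (n : ℝ) ^ 2 := by positivity
  have hf := sq_nonneg ‖f‖
  have hg := sq_nonneg ‖g‖
  have a1 := mul_le_mul_of_nonneg_right hx (mul_nonneg h0 hf)
  have a2 := mul_le_mul_of_nonneg_right hy hg
  have a3 := mul_le_mul_of_nonneg_right hz hf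
  have a4 := mul_le_mul_of_nonneg_right hw hg
  have a5 := mul_le_mul_of_nonneg_left e1 h0
  nlinarith

theorem linearPosition_eq (n : ℤ) (t : ℝ) (f g : ℂ) : linearPosition n t f g =
    ((propagator' n t + propagator n t : ℝ) : ℂ) * f + (propagator n t : ℂ) * g := by
  simp only [linearPosition]
  push_cast
  ring

theorem linearVelocity_eq (n : ℤ) (t : ℝ) (f g : ℂ) : linearVelocity n t f g =
    ((-((1 + (n : ℝ) ^ 2) * propagator n t) : ℝ) : ℂ) * f + (propagator' n t : ℂ) * g := by
  simp only [linearVelocity, propagator''_eq]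
  push_cast
  ring

theorem energy_linear_le (n : ℤ) {t : ℝ} (ht : 0 ≤ t) (f g : ℂ) :
    energy n (linearPosition n t f g) (linearVelocity n t f g) ≤ 32 * energy n f g := by
  have h := propagator_energy_le n ht
  have h0 : 0 ≤ (n : ℝ) ^ 2 := by positivity
  have h1 := sq_nonneg (propagator n t)
  have h2 := sq_nonneg (propagator' n t)
  have h3 := mul_nonneg h0 h1
  rw [linearPosition_eq, linearVelocity_eq]
  refine (energy_matrix_le n f g (C := 8) ?_ ?_ ?_ ?_).trans (by linarith)
  · nlinarith [sq_nonneg (propagator n t - propagator' n t)]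
  · nlinarith
  · have := mul_le_mul_of_nonneg_left h (by positivity : 0 ≤ 1 + (n : ℝ) ^ 2)
    nlinarith [mul_nonneg (by positivity : 0 ≤ 1 + (n : ℝ) ^ 2) h2]
  · nlinarith

/-- The inverse of the linear flow is bounded. -/
theorem energy_le_linear (n : ℤ) {t : ℝ} (ht : 0 ≤ t) (f g : ℂ) :
    energy n f g ≤ 32 * Real.exp t ^ 2 *
      energy n (linearPosition n t f g) (linearVelocity n t f g) := by
  set p := linearPosition n t f g with hp
  set v := linearVelocity n t f g with hv
  rw [linearPosition_eq] at hp
  rw [linearVelocity_eq] at hv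
  have hw := propagator_wronskian n t
  have he : Real.exp t * Real.exp (-t) = 1 := by rw [← Real.exp_add]; simp
  have hwc : (Real.exp t : ℂ) * ((propagator' n t : ℂ) ^ 2 + propagator n t * propagator' n t
      + (1 + (n : ℂ) ^ 2) * (propagator n t : ℂ) ^ 2) = 1 := by
    rw [← hw] at he
    exact_mod_cast he
  -- Cramer's rule: the determinant of the linear flow on one mode is the Wronskian, equal to
  -- `e^{-t}`. The inverse matrix has entries of the same size, up to the factor `e^t`.
  have hf : f = Real.exp t * (((propagator' n t : ℝ) : ℂ) * p +
      ((-propagator n t : ℝ) : ℂ) * v) := by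
    rw [hp, hv]
    push_cast
    push_cast at hwc
    linear_combination (-f) * hwc
  have hg : g = Real.exp t * ((((1 + (n : ℝ) ^ 2) * propagator n t : ℝ) : ℂ) * p +
      ((propagator' n t + propagator n t : ℝ) : ℂ) * v) := by
    rw [hp, hv]
    push_cast
    push_cast at hwc
    linear_combination (-g) * hwc
  have h := propagator_energy_le n ht
  have h0 : 0 ≤ (n : ℝ) ^ 2 := by positivity
  have h1 := sq_nonneg (propagator n t)
  have h2 := sq_nonneg (propagator' n t)
  have h3 := mul_nonneg h0 h1
  have key : energy n (((propagator' n t : ℝ) : ℂ) * p + ((-propagator n t : ℝ) : ℂ) * v)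
      ((((1 + (n : ℝ) ^ 2) * propagator n t : ℝ) : ℂ) * p +
      ((propagator' n t + propagator n t : ℝ) : ℂ) * v) ≤ 4 * 8 * energy n p v := by
    refine energy_matrix_le n p v (C := 8) ?_ ?_ ?_ ?_
    · nlinarith
    · nlinarith
    · have := mul_le_mul_of_nonneg_left h (by positivity : 0 ≤ 1 + (n : ℝ) ^ 2)
      nlinarith [mul_nonneg (by positivity : 0 ≤ 1 + (n : ℝ) ^ 2) h2]
    · nlinarith [sq_nonneg (propagator n t - propagator' n t)]
  have h4 : energy n f g = Real.exp t ^ 2 * energy n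
      (((propagator' n t : ℝ) : ℂ) * p + ((-propagator n t : ℝ) : ℂ) * v)
      ((((1 + (n : ℝ) ^ 2) * propagator n t : ℝ) : ℂ) * p +
      ((propagator' n t + propagator n t : ℝ) : ℂ) * v) := by
    nth_rewrite 1 [hf, hg]
    rw [energy_mul, Complex.norm_real, Real.norm_of_nonneg (Real.exp_pos t).le]
  rw [h4]
  nlinarith [mul_le_mul_of_nonneg_left key (sq_nonneg (Real.exp t))]

open Filter Topology

/-! ### Square summable sequences -/

/-- The space `ℓ²(ℤ)`. -/
abbrev EllTwo : Type := lp (fun _ : ℤ => ℂ) 2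

theorem memℓp_two_iff {a : ℤ → ℂ} : Memℓp a 2 ↔ Summable fun n => ‖a n‖ ^ 2 := by
  rw [memℓp_gen_iff (by norm_num)]
  simp

theorem EllTwo.hasSum_norm_sq (x : EllTwo) : HasSum (fun n => ‖x n‖ ^ 2) (‖x‖ ^ 2) := by
  have h := lp.hasSum_norm (p := 2) (by norm_num) x
  simpa using h

theorem EllTwo.sum_norm_sq_le (x : EllTwo) (F : Finset ℤ) : ∑ n ∈ F, ‖x n‖ ^ 2 ≤ ‖x‖ ^ 2 :=
  sum_le_hasSum F (fun _ _ => by positivity) x.hasSum_norm_sq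

theorem EllTwo.norm_le_of_forall_sum_le {x : EllTwo} {C : ℝ} (hC : 0 ≤ C)
    (h : ∀ F : Finset ℤ, ∑ n ∈ F, ‖x n‖ ^ 2 ≤ C ^ 2) : ‖x‖ ≤ C :=
  lp.norm_le_of_forall_sum_le (by norm_num) hC fun F => by simpa using h F

theorem EllTwo.continuous_apply (n : ℤ) : Continuous fun x : EllTwo => x n :=
  (lp.lipschitzWith_one_eval 2 n).continuous

/-- Dominated convergence for series: a locally uniform summable majorant upgrades coordinatewise
continuity to continuity in the `ℓ²` norm. -/
theorem EllTwo.exists_continuousMap {X : Type*} [TopologicalSpace X] {a : X → ℤ → ℂ}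
    (hc : ∀ n, Continuous fun x => a x n)
    (hd : ∀ x₀, ∃ d : ℤ → ℝ, Summable d ∧ ∀ᶠ x in 𝓝 x₀, ∀ n, ‖a x n‖ ^ 2 ≤ d n) :
    ∃ A : C(X, EllTwo), ∀ x n, A x n = a x n := by
  have hm : ∀ x, Memℓp (a x) 2 := by
    intro x
    obtain ⟨d, hd, hx⟩ := hd x
    exact memℓp_two_iff.2 (hd.of_nonneg_of_le (fun _ => by positivity) hx.self_of_nhds)
  refine ⟨⟨fun x => ⟨a x, hm x⟩, ?_⟩, fun _ _ => rfl⟩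
  refine continuous_iff_continuousAt.2 fun x₀ => ?_
  rw [ContinuousAt, tendsto_iff_norm_sub_tendsto_zero]
  obtain ⟨d, hds, hx⟩ := hd x₀
  have hsq : Tendsto (fun x => ∑' n, ‖a x n - a x₀ n‖ ^ 2) (𝓝 x₀) (𝓝 (∑' _ : ℤ, (0 : ℝ))) := by
    refine tendsto_tsum_of_dominated_convergence (bound := fun n => 4 * d n)
      (hds.mul_left 4) (fun n => ?_) ?_
    · have h : Tendsto (fun x => ‖a x n - a x₀ n‖ ^ 2) (𝓝 x₀) (𝓝 (‖a x₀ n - a x₀ n‖ ^ 2)) :=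
        ((((hc n).sub continuous_const).norm).pow 2).tendsto x₀
      simpa using h
    · filter_upwards [hx] with x hxn n
      rw [Real.norm_of_nonneg (by positivity), sub_eq_add_neg]
      have h1 := norm_add_sq_le_two (a x n) (-a x₀ n)
      rw [norm_neg] at h1
      have h2 := hxn n
      have h3 := hx.self_of_nhds n
      linarith
  rw [tsum_zero] at hsq
  have hsqrt := hsq.sqrt
  rw [Real.sqrt_zero] at hsqrt
  refine hsqrt.congr fun x => ?_
  rw [Real.sqrt_eq_iff_eq_sq (tsum_nonneg fun _ => by positivity) (norm_nonneg _)]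
  exact (EllTwo.hasSum_norm_sq ((⟨a x, hm x⟩ : EllTwo) - ⟨a x₀, hm x₀⟩)).tsum_eq

/-! ### Weights and Sobolev spaces -/

theorem one_le_weight (n : ℤ) : (1 : ℝ) ≤ 1 + (n : ℝ) ^ 2 := by nlinarith [sq_nonneg (n : ℝ)]

theorem weight_pos (n : ℤ) : (0 : ℝ) < 1 + (n : ℝ) ^ 2 := by positivity

theorem weight_sub_one_mul (σ : ℝ) (n : ℤ) :
    (1 + (n : ℝ) ^ 2) ^ (σ - 1) * (1 + (n : ℝ) ^ 2) = (1 + (n : ℝ) ^ 2) ^ σ := by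
  nth_rewrite 2 [← Real.rpow_one (1 + (n : ℝ) ^ 2)]
  rw [← Real.rpow_add (weight_pos n)]
  ring_nf

theorem summable_weight {a : ℝ} (ha : a < -(1 / 2)) :
    Summable fun n : ℤ => (1 + (n : ℝ) ^ 2) ^ a := by
  have h1 : Summable fun n : ℤ => |(n : ℝ)| ^ (-(-(2 * a))) :=
    Real.summable_abs_int_rpow (by linarith)
  -- Accounts for the mode `n = 0`, where the comparison term `|n|^{2a}` evaluates to `0`.
  have h2 : Summable fun n : ℤ => if n = 0 then (1 : ℝ) else 0 :=
    summable_of_ne_finset_zero (s := {0}) fun n hn => by simpa using hn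
  refine (h1.add h2).of_nonneg_of_le (fun n => Real.rpow_nonneg (weight_pos n).le _) fun n => ?_
  by_cases hn : n = 0
  · subst hn
    simp only [Int.cast_zero, ne_eq, OfNat.ofNat_ne_zero, not_false_eq_true, zero_pow, add_zero,
      Real.one_rpow, if_true]
    have : 0 ≤ |(0 : ℝ)| ^ (-(-(2 * a))) := Real.rpow_nonneg (abs_nonneg _) _
    linarith
  · simp only [hn, if_false, add_zero]
    have h0 : (0 : ℝ) < (n : ℝ) ^ 2 := by positivity
    have h3 : |(n : ℝ)| ^ (-(-(2 * a))) = ((n : ℝ) ^ 2) ^ a := by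
      rw [neg_neg, Real.rpow_mul (abs_nonneg _), Real.rpow_two, sq_abs]
    rw [h3]
    exact Real.rpow_le_rpow_of_nonpos h0 (by linarith) (by linarith)

theorem MemH.mono {s σ : ℝ} (h : s ≤ σ) {a : ℤ → ℂ} (ha : MemH σ a) : MemH s a :=
  Summable.of_nonneg_of_le (fun n => by positivity)
    (fun n => mul_le_mul_of_nonneg_right
      (Real.rpow_le_rpow_of_exponent_le (one_le_weight n) h) (by positivity)) ha

theorem MemH.add {σ : ℝ} {a b : ℤ → ℂ} (ha : MemH σ a) (hb : MemH σ b) :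
    MemH σ fun n => a n + b n := by
  refine MemH.of_memℓp ?_
  convert ha.memℓp.add hb.memℓp using 1
  funext n
  simp [mul_add]

theorem MemH.const_mul {σ : ℝ} {a : ℤ → ℂ} (c : ℂ) (ha : MemH σ a) :
    MemH σ fun n => c * a n := by
  refine (Summable.mul_left (‖c‖ ^ 2) ha).congr fun n => ?_
  rw [norm_mul, mul_pow]
  ring

/-- Position and velocity are merged into one weighted sum of mode energies, so that every
regularity statement reduces to an energy estimate mode by mode. -/
theorem memH_pair_iff {σ : ℝ} {a b : ℤ → ℂ} : (MemH σ a ∧ MemH (σ - 1) b) ↔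
    Summable fun n : ℤ => (1 + (n : ℝ) ^ 2) ^ (σ - 1) * energy n (a n) (b n) := by
  have he : ∀ n : ℤ, (1 + (n : ℝ) ^ 2) ^ (σ - 1) * energy n (a n) (b n)
      = (1 + (n : ℝ) ^ 2) ^ σ * ‖a n‖ ^ 2 + (1 + (n : ℝ) ^ 2) ^ (σ - 1) * ‖b n‖ ^ 2 := by
    intro n
    rw [energy, mul_add, ← mul_assoc, weight_sub_one_mul]
  simp only [he]
  constructor
  · rintro ⟨h1, h2⟩
    exact Summable.add h1 h2
  · intro h
    constructor
    · exact h.of_nonneg_of_le (fun n => by positivity) fun n => le_add_of_nonneg_right (by positivity)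
    · exact h.of_nonneg_of_le (fun n => by positivity) fun n => le_add_of_nonneg_left (by positivity)

theorem InPhase.mono {s σ σ' : ℝ} (h : σ ≤ σ') {u : Phase s} (hu : InPhase σ' u) : InPhase σ u :=
  ⟨hu.1.mono h, hu.2.mono (by linarith)⟩

theorem inPhase_self {s : ℝ} (u : Phase s) : InPhase s u := ⟨u.1.2.1, u.2.2.1⟩

namespace Sobolev

variable {s : ℝ}

theorem coeff_neg_eq (u : Sobolev s) (n : ℤ) : u.coeff (-n) = conj (u.coeff n) := u.2.2 n

theorem ext_coeff {u v : Sobolev s} (h : ∀ n, u.coeff n = v.coeff n) : u = v :=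
  Subtype.ext (funext h)

theorem isInducing_toEll2 (s : ℝ) : Topology.IsInducing (toEll2 s) := ⟨rfl⟩

theorem toEll2_apply (u : Sobolev s) (n : ℤ) :
    toEll2 s u n = (((1 + (n : ℝ) ^ 2) ^ (s / 2) : ℝ) : ℂ) * u.coeff n := rfl

theorem norm_weight_sq (s : ℝ) (n : ℤ) (z : ℂ) :
    ‖(((1 + (n : ℝ) ^ 2) ^ (s / 2) : ℝ) : ℂ) * z‖ ^ 2 = (1 + (n : ℝ) ^ 2) ^ s * ‖z‖ ^ 2 := by
  rw [norm_mul, mul_pow, Complex.norm_real, Real.norm_of_nonneg (by positivity),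
    ← Real.rpow_natCast, ← Real.rpow_mul (weight_pos n).le]
  congr 2
  push_cast
  ring

theorem continuous_coeff (n : ℤ) : Continuous fun u : Sobolev s => u.coeff n := by
  have h0 : (((1 + (n : ℝ) ^ 2) ^ (s / 2) : ℝ) : ℂ) ≠ 0 :=
    Complex.ofReal_ne_zero.2 (Real.rpow_pos_of_pos (weight_pos n) _).ne'
  have h : Continuous fun u : Sobolev s => toEll2 s u n :=
    (EllTwo.continuous_apply n).comp (isInducing_toEll2 s).continuous
  refine (h.const_mul ((((1 + (n : ℝ) ^ 2) ^ (s / 2) : ℝ) : ℂ)⁻¹)).congr fun u => ?_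
  rw [toEll2_apply, inv_mul_cancel_left₀ h0]

theorem exists_continuousMap {X : Type*} [TopologicalSpace X] {a : X → ℤ → ℂ}
    (hc : ∀ n, Continuous fun x => a x n) (hr : ∀ x n, a x (-n) = conj (a x n))
    (hd : ∀ x₀, ∃ d : ℤ → ℝ, Summable d ∧
      ∀ᶠ x in 𝓝 x₀, ∀ n : ℤ, (1 + (n : ℝ) ^ 2) ^ s * ‖a x n‖ ^ 2 ≤ d n) :
    ∃ A : C(X, Sobolev s), ∀ x n, (A x).coeff n = a x n := by
  obtain ⟨B, hB⟩ := EllTwo.exists_continuousMap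
    (a := fun x n => (((1 + (n : ℝ) ^ 2) ^ (s / 2) : ℝ) : ℂ) * a x n)
    (fun n => continuous_const.mul (hc n)) (by simpa only [norm_weight_sq] using hd)
  have hm : ∀ x, MemH s (a x) := by
    intro x
    obtain ⟨d, hd, hx⟩ := hd x
    exact hd.of_nonneg_of_le (fun _ => by positivity) hx.self_of_nhds
  refine ⟨⟨fun x => ⟨a x, hm x, hr x⟩, (isInducing_toEll2 s).continuous_iff.2 ?_⟩,
    fun _ _ => rfl⟩
  refine B.continuous.congr fun x => ?_
  ext n
  rw [hB]
  rfl

/-- The inclusion of `H^s`, `s ≥ 0`, into `L²`, in terms of Fourier coefficients. -/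
theorem exists_continuousMap_ellTwo (hs : 0 ≤ s) :
    ∃ J : C(Sobolev s, EllTwo), ∀ u n, J u n = u.coeff n := by
  have hm : ∀ u : Sobolev s, Memℓp u.coeff 2 := fun u => by
    have h := u.2.1.mono hs
    rw [memℓp_two_iff]
    refine h.congr fun n => ?_
    rw [Real.rpow_zero, one_mul]
    rfl
  refine ⟨⟨fun u => ⟨u.coeff, hm u⟩, ?_⟩, fun _ _ => rfl⟩
  refine (LipschitzWith.mk_one fun u v => ?_).continuous
  rw [dist_eq_norm, dist_eq_norm]
  refine EllTwo.norm_le_of_forall_sum_le (norm_nonneg _) fun F => ?_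
  refine le_trans (Finset.sum_le_sum fun n _ => ?_) (EllTwo.sum_norm_sq_le (toEll2 s (u - v)) F)
  rw [toEll2_apply, norm_weight_sq]
  exact le_mul_of_one_le_left (by positivity) (Real.one_le_rpow (one_le_weight n) hs)

end Sobolev

/-! ### Paths in phase space -/

/-- A path of pairs of sequences with continuous coordinates which is locally dominated in
`H^σ × H^{σ-1}`. -/
structure IsPhasePath (σ : ℝ) (a b : ℝ≥0 → ℤ → ℂ) : Prop where
  continuous_fst : ∀ n, Continuous fun t => a t n
  continuous_snd : ∀ n, Continuous fun t => b t n
  dominated : ∀ T : ℝ≥0, ∃ d : ℤ → ℝ, Summable d ∧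
    ∀ t ≤ T, ∀ n : ℤ, (1 + (n : ℝ) ^ 2) ^ (σ - 1) * energy n (a t n) (b t n) ≤ d n

namespace IsPhasePath

variable {σ : ℝ} {a b a' b' : ℝ≥0 → ℤ → ℂ}

theorem add (h : IsPhasePath σ a b) (h' : IsPhasePath σ a' b') :
    IsPhasePath σ (fun t n => a t n + a' t n) (fun t n => b t n + b' t n) where
  continuous_fst n := (h.continuous_fst n).add (h'.continuous_fst n)
  continuous_snd n := (h.continuous_snd n).add (h'.continuous_snd n)
  dominated T := by
    obtain ⟨d, hd, H⟩ := h.dominated T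
    obtain ⟨d', hd', H'⟩ := h'.dominated T
    refine ⟨fun n => 2 * (d n + d' n), (hd.add hd').mul_left 2, fun t ht n => ?_⟩
    have h1 := H t ht n
    have h2 := H' t ht n
    have h3 := mul_le_mul_of_nonneg_left (energy_add_le n (a t n) (a' t n) (b t n) (b' t n))
      (Real.rpow_nonneg (weight_pos n).le (σ - 1))
    linarith

theorem const_mul (c : ℂ) (h : IsPhasePath σ a b) :
    IsPhasePath σ (fun t n => c * a t n) (fun t n => c * b t n) where
  continuous_fst n := (h.continuous_fst n).const_mul c
  continuous_snd n := (h.continuous_snd n).const_mul c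
  dominated T := by
    obtain ⟨d, hd, H⟩ := h.dominated T
    refine ⟨fun n => ‖c‖ ^ 2 * d n, hd.mul_left _, fun t ht n => ?_⟩
    rw [energy_mul, mul_left_comm]
    exact mul_le_mul_of_nonneg_left (H t ht n) (by positivity)

theorem summable (h : IsPhasePath σ a b) (t : ℝ≥0) :
    Summable fun n : ℤ => (1 + (n : ℝ) ^ 2) ^ (σ - 1) * energy n (a t n) (b t n) := by
  obtain ⟨d, hd, H⟩ := h.dominated t
  exact hd.of_nonneg_of_le
    (fun n => mul_nonneg (Real.rpow_nonneg (weight_pos n).le _) (energy_nonneg _ _ _)) (H t le_rfl)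

theorem dominated_fst (h : IsPhasePath σ a b) (t₀ : ℝ≥0) : ∃ d : ℤ → ℝ, Summable d ∧
    ∀ᶠ t in 𝓝 t₀, ∀ n : ℤ, (1 + (n : ℝ) ^ 2) ^ σ * ‖a t n‖ ^ 2 ≤ d n := by
  obtain ⟨d, hd, H⟩ := h.dominated (t₀ + 1)
  refine ⟨d, hd, ?_⟩
  filter_upwards [Iic_mem_nhds (lt_add_one t₀)] with t ht n
  refine le_trans ?_ (H t ht n)
  rw [energy, mul_add, ← mul_assoc, weight_sub_one_mul]
  exact le_add_of_nonneg_right (by positivity)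

theorem dominated_snd (h : IsPhasePath σ a b) (t₀ : ℝ≥0) : ∃ d : ℤ → ℝ, Summable d ∧
    ∀ᶠ t in 𝓝 t₀, ∀ n : ℤ, (1 + (n : ℝ) ^ 2) ^ (σ - 1) * ‖b t n‖ ^ 2 ≤ d n := by
  obtain ⟨d, hd, H⟩ := h.dominated (t₀ + 1)
  refine ⟨d, hd, ?_⟩
  filter_upwards [Iic_mem_nhds (lt_add_one t₀)] with t ht n
  refine le_trans ?_ (H t ht n)
  rw [energy, mul_add]
  exact le_add_of_nonneg_left (by positivity)

theorem exists_continuousMap (h : IsPhasePath σ a b) (ha : ∀ t n, a t (-n) = conj (a t n))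
    (hb : ∀ t n, b t (-n) = conj (b t n)) :
    ∃ Φ : C(ℝ≥0, Phase σ), ∀ t n, (Φ t).1.coeff n = a t n ∧ (Φ t).2.coeff n = b t n := by
  obtain ⟨A, hA⟩ := Sobolev.exists_continuousMap (s := σ) h.continuous_fst ha h.dominated_fst
  obtain ⟨B, hB⟩ := Sobolev.exists_continuousMap (s := σ - 1) h.continuous_snd hb h.dominated_snd
  exact ⟨A.prodMk B, fun t n => ⟨hA t n, hB t n⟩⟩

theorem exists_continuousMap_ellTwo (hσ : 0 ≤ σ) (h : IsPhasePath σ a b) :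
    ∃ A : C(ℝ≥0, EllTwo), ∀ t n, A t n = a t n := by
  refine EllTwo.exists_continuousMap h.continuous_fst fun t₀ => ?_
  obtain ⟨d, hd, H⟩ := h.dominated_fst t₀
  refine ⟨d, hd, H.mono fun t ht n => le_trans ?_ (ht n)⟩
  exact le_mul_of_one_le_left (by positivity) (Real.one_le_rpow (one_le_weight n) hσ)

end IsPhasePath

theorem isPhasePath_linear {σ : ℝ} {f g : ℤ → ℂ} (h : MemH σ f ∧ MemH (σ - 1) g) :
    IsPhasePath σ (fun t n => linearPosition n t (f n) (g n))
      (fun t n => linearVelocity n t (f n) (g n)) where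
  continuous_fst n := by
    have h1 := (continuous_propagator n).comp NNReal.continuous_coe
    have h2 := (continuous_propagator' n).comp NNReal.continuous_coe
    simp only [linearPosition_eq]
    simp only [Function.comp_def] at h1 h2
    fun_prop
  continuous_snd n := by
    have h1 := (continuous_propagator n).comp NNReal.continuous_coe
    have h2 := (continuous_propagator' n).comp NNReal.continuous_coe
    simp only [linearVelocity_eq]
    simp only [Function.comp_def] at h1 h2
    fun_prop
  dominated T := by
    refine ⟨_, (memH_pair_iff.1 h).mul_left 32, fun t _ n => ?_⟩
    rw [mul_left_comm]
    exact mul_le_mul_of_nonneg_left (energy_linear_le n t.2 _ _)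
      (Real.rpow_nonneg (weight_pos n).le _)

/-- The linear flow preserves the Sobolev regularity in both directions of time. -/
theorem memH_linear_iff {σ : ℝ} {f g : ℤ → ℂ} (t : ℝ≥0) :
    (MemH σ (fun n => linearPosition n t (f n) (g n)) ∧
      MemH (σ - 1) (fun n => linearVelocity n t (f n) (g n))) ↔ (MemH σ f ∧ MemH (σ - 1) g) := by
  constructor
  · intro h
    rw [memH_pair_iff] at h ⊢
    refine (h.mul_left (32 * Real.exp t ^ 2)).of_nonneg_of_le
      (fun n => mul_nonneg (Real.rpow_nonneg (weight_pos n).le _) (energy_nonneg _ _ _))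
      fun n => ?_
    rw [mul_left_comm]
    exact mul_le_mul_of_nonneg_left (energy_le_linear n t.2 _ _)
      (Real.rpow_nonneg (weight_pos n).le _)
  · intro h
    exact memH_pair_iff.2 ((isPhasePath_linear h).summable t)

/-! ### The nonlinearity -/

theorem sinCoeff_neg (β : ℝ) (a : ℤ → ℂ) (n : ℤ) :
    sinCoeff β a (-n) = conj (sinCoeff β a n) := by
  simp only [sinCoeff, fourierCoeff, ← integral_conj]
  refine integral_congr_ae (Eventually.of_forall fun x => ?_)
  simp only [smul_eq_mul, map_mul, Complex.conj_ofReal, neg_neg, ← fourier_neg]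

theorem abs_sin_mul_sub_sin_mul_le (β x y : ℝ) :
    |Real.sin (β * x) - Real.sin (β * y)| ≤ |β| * |x - y| := by
  have h := Real.abs_sin_sub_sin_le (β * x) (β * y)
  rwa [← mul_sub, abs_mul] at h

/-- The superposition operator `u ↦ sin(βu)` on `L²`, in terms of Fourier coefficients. -/
theorem exists_sinMap (β : ℝ) : ∃ S : EllTwo → EllTwo, (∀ a n, S a n = sinCoeff β a n) ∧
    (∀ a, ‖S a‖ ≤ 1) ∧ ∀ a b, ‖S a - S b‖ ≤ |β| * ‖a - b‖ := by
  let f : EllTwo → Lp ℂ 2 (AddCircle.haarAddCircle (T := 2 * π)) :=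
    fun a => (fourierBasis (T := 2 * π)).repr.symm a
  let g : EllTwo → AddCircle (2 * π) → ℂ := fun a x => ((Real.sin (β * (f a x).re) : ℝ) : ℂ)
  have hbd : ∀ a x, ‖g a x‖ ≤ 1 := fun a x => by
    rw [Complex.norm_real]
    exact Real.abs_sin_le_one _
  have hg : ∀ a, MemLp (g a) 2 (AddCircle.haarAddCircle (T := 2 * π)) := fun a => by
    refine MemLp.of_bound ?_ 1 (Eventually.of_forall (hbd a))
    have hc : Continuous fun z : ℂ => ((Real.sin (β * z.re) : ℝ) : ℂ) := by fun_prop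
    exact hc.comp_aestronglyMeasurable (Lp.aestronglyMeasurable (f a))
  refine ⟨fun a => (fourierBasis (T := 2 * π)).repr ((hg a).toLp _), fun a n => ?_, fun a => ?_,
    fun a b => ?_⟩
  · rw [fourierBasis_repr, fourierCoeff_congr_ae (hg a).coeFn_toLp]
    congr 1
    funext x
    have hm : Memℓp (⇑a) 2 := lp.memℓp a
    simp only [g, realize, hm, dif_pos]
    rfl
  · rw [LinearIsometryEquiv.norm_map]
    have h := Lp.norm_le_of_ae_bound (f := (hg a).toLp _) (C := 1) zero_le_one (by
      filter_upwards [(hg a).coeFn_toLp] with x hx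
      rw [hx]
      exact hbd a x)
    -- Haar measure on the circle is normalized, so the total mass contributes a factor `1`.
    refine h.trans (le_of_eq ?_)
    simp [measureUnivNNReal]
  · rw [← map_sub, LinearIsometryEquiv.norm_map]
    have hf : ‖a - b‖ = ‖f a - f b‖ := by
      simp only [f, ← map_sub, LinearIsometryEquiv.norm_map]
    rw [hf]
    refine Lp.norm_le_mul_norm_of_ae_le_mul ?_
    filter_upwards [(hg a).coeFn_toLp, (hg b).coeFn_toLp, Lp.coeFn_sub ((hg a).toLp _)
      ((hg b).toLp _), Lp.coeFn_sub (f a) (f b)] with x h1 h2 h3 h4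
    rw [h3, h4, Pi.sub_apply, Pi.sub_apply, h1, h2]
    simp only [g]
    rw [← Complex.ofReal_sub, Complex.norm_real, Real.norm_eq_abs]
    refine (abs_sin_mul_sub_sin_mul_le _ _ _).trans ?_
    refine mul_le_mul_of_nonneg_left ?_ (abs_nonneg _)
    rw [← Complex.sub_re]
    exact Complex.abs_re_le_norm _

/-! ### Convolutions with the propagator -/

/-- A weighted Cauchy-Schwarz inequality. -/
theorem sq_integral_le_mul_integral {h w : ℝ → ℝ} {t : ℝ} (ht : 0 ≤ t) (hh : Continuous h)
    (hw : Continuous w) (hpos : ∀ r, 0 < w r) :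
    (∫ r in (0 : ℝ)..t, h r) ^ 2 ≤ (∫ r in (0 : ℝ)..t, w r) * ∫ r in (0 : ℝ)..t, h r ^ 2 / w r := by
  have hq : Continuous fun r => h r ^ 2 / w r := (hh.pow 2).div hw fun r => (hpos r).ne'
  rcases ht.eq_or_lt with rfl | ht
  · simp
  have hW : 0 < ∫ r in (0 : ℝ)..t, w r :=
    intervalIntegral.intervalIntegral_pos_of_pos (hw.intervalIntegrable _ _) hpos ht
  set A := ∫ r in (0 : ℝ)..t, h r with hA
  set B := ∫ r in (0 : ℝ)..t, w r with hB
  -- Integrate `(h - c w)² / w ≥ 0` with the optimal constant `c = A / B`.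
  have hmono : 2 * (A / B) * A - (A / B) ^ 2 * B ≤ ∫ r in (0 : ℝ)..t, h r ^ 2 / w r := by
    rw [hA, hB, ← intervalIntegral.integral_const_mul, ← intervalIntegral.integral_const_mul,
      ← intervalIntegral.integral_sub ((hh.const_mul _).intervalIntegrable _ _)
        ((hw.const_mul _).intervalIntegrable _ _), ← hA, ← hB]
    refine intervalIntegral.integral_mono_on ht.le
      (((hh.const_mul _).sub (hw.const_mul _)).intervalIntegrable _ _)
      (hq.intervalIntegrable _ _) fun r _ => ?_
    rw [le_div_iff₀ (hpos r)]
    nlinarith [sq_nonneg (h r - A / B * w r)]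
  have he : 2 * (A / B) * A - (A / B) ^ 2 * B = A ^ 2 / B := by
    field_simp
    ring
  rw [he, div_le_iff₀ hW] at hmono
  linarith

theorem integral_exp_mul_le {K t : ℝ} (hK : 0 < K) :
    ∫ r in (0 : ℝ)..t, Real.exp (K * r) ≤ Real.exp (K * t) / K := by
  rw [intervalIntegral.integral_comp_mul_left (fun x => Real.exp x) hK.ne', integral_exp,
    smul_eq_mul, mul_zero, Real.exp_zero, div_eq_inv_mul]
  exact mul_le_mul_of_nonneg_left (by linarith) (by positivity)

/-- Minkowski's integral inequality for exponentially growing sequences. -/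
theorem sum_sq_integral_le {h : ℤ → ℝ → ℝ} {t A K : ℝ} (ht : 0 ≤ t) (hK : 0 < K)
    (hh : ∀ n, Continuous (h n)) (F : Finset ℤ)
    (hA : ∀ r, 0 ≤ r → r ≤ t → ∑ n ∈ F, h n r ^ 2 ≤ A ^ 2 * Real.exp (K * r) ^ 2) :
    ∑ n ∈ F, (∫ r in (0 : ℝ)..t, h n r) ^ 2 ≤ (A * Real.exp (K * t) / K) ^ 2 := by
  have hw : Continuous fun r => Real.exp (K * r) := by fun_prop
  have hq : ∀ n, Continuous fun r => h n r ^ 2 / Real.exp (K * r) := fun n =>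
    ((hh n).pow 2).div hw fun r => (Real.exp_pos _).ne'
  have hI := integral_exp_mul_le (t := t) hK
  have hI0 : 0 ≤ ∫ r in (0 : ℝ)..t, Real.exp (K * r) :=
    intervalIntegral.integral_nonneg ht fun r _ => (Real.exp_pos _).le
  -- Cauchy-Schwarz is used with weight `e^{Kr}`, so that after summation over the modes both
  -- factors are multiples of `∫ e^{Kr} ≤ e^{Kt} / K`. The gain `1 / K` is what later makes the map
  -- contracting.
  calc ∑ n ∈ F, (∫ r in (0 : ℝ)..t, h n r) ^ 2
      ≤ ∑ n ∈ F, (∫ r in (0 : ℝ)..t, Real.exp (K * r)) *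
          ∫ r in (0 : ℝ)..t, h n r ^ 2 / Real.exp (K * r) :=
        Finset.sum_le_sum fun n _ =>
          sq_integral_le_mul_integral ht (hh n) hw fun r => Real.exp_pos _
    _ = (∫ r in (0 : ℝ)..t, Real.exp (K * r)) *
          ∫ r in (0 : ℝ)..t, ∑ n ∈ F, h n r ^ 2 / Real.exp (K * r) := by
        rw [← Finset.mul_sum, intervalIntegral.integral_finsetSum fun n _ =>
          (hq n).intervalIntegrable _ _]
    _ ≤ (∫ r in (0 : ℝ)..t, Real.exp (K * r)) *
          ∫ r in (0 : ℝ)..t, A ^ 2 * Real.exp (K * r) := by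
        refine mul_le_mul_of_nonneg_left ?_ hI0
        refine intervalIntegral.integral_mono_on ht
          ((continuous_finsetSum F fun n _ => hq n).intervalIntegrable _ _)
          ((hw.const_mul _).intervalIntegrable _ _) fun r hr => ?_
        rw [← Finset.sum_div, div_le_iff₀ (Real.exp_pos _)]
        have := hA r hr.1 hr.2
        nlinarith
    _ = A ^ 2 * (∫ r in (0 : ℝ)..t, Real.exp (K * r)) ^ 2 := by
        rw [intervalIntegral.integral_const_mul]
        ring
    _ ≤ A ^ 2 * (Real.exp (K * t) / K) ^ 2 := by gcongr
    _ = (A * Real.exp (K * t) / K) ^ 2 := by ring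

theorem norm_integral_mul_le {k : ℝ → ℝ} {q : ℝ → ℂ} {t C : ℝ} (ht : 0 ≤ t)
    (hk : ∀ r, 0 ≤ r → |k r| ≤ C) (hkc : Continuous k) (hq : Continuous q) :
    ‖∫ r in (0 : ℝ)..t, (k (t - r) : ℂ) * q r‖ ≤ C * ∫ r in (0 : ℝ)..t, ‖q r‖ := by
  rw [← intervalIntegral.integral_const_mul]
  refine (intervalIntegral.norm_integral_le_integral_norm ht).trans ?_
  refine intervalIntegral.integral_mono_on ht (Continuous.intervalIntegrable (by fun_prop) _ _)
    (Continuous.intervalIntegrable (by fun_prop) _ _) fun r hr => ?_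
  rw [norm_mul, Complex.norm_real]
  exact mul_le_mul_of_nonneg_right (hk _ (by linarith [hr.2])) (norm_nonneg _)

theorem continuous_convolution {k : ℝ → ℝ} {q : ℝ → ℂ} (hk : Continuous k) (hq : Continuous q) :
    Continuous fun t : ℝ≥0 => ∫ r in (0 : ℝ)..t, (k (t - r) : ℂ) * q r := by
  have h : Continuous fun t : ℝ => ∫ r in (0 : ℝ)..t, (k (t - r) : ℂ) * q r :=
    intervalIntegral.continuous_parametric_intervalIntegral_of_continuous (by fun_prop)
      continuous_id
  exact h.comp NNReal.continuous_coe

/-- The Duhamel integral of a locally bounded path in `ℓ²` is a path in `H^1 × L²`. -/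
theorem isPhasePath_duhamel {σ : ℝ} (hσ : σ ≤ 1) {q : ℝ → ℤ → ℂ} (hq : ∀ n, Continuous fun r => q r n)
    (hq1 : ∀ r (F : Finset ℤ), ∑ n ∈ F, ‖q r n‖ ^ 2 ≤ 1) :
    IsPhasePath σ (fun t n => ∫ r in (0 : ℝ)..t, (propagator n (t - r) : ℂ) * q r n)
      (fun t n => ∫ r in (0 : ℝ)..t, (propagator' n (t - r) : ℂ) * q r n) where
  continuous_fst n := continuous_convolution (continuous_propagator n) (hq n)
  continuous_snd n := continuous_convolution (continuous_propagator' n) (hq n)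
  dominated T := by
    -- The constant is `4 + 4`, from `⟨n⟩|D| ≤ 2` and `|D'| ≤ 2`. Extending the integral from `t` to
    -- `T` makes the majorant independent of `t`.
    refine ⟨fun n => 8 * (∫ r in (0 : ℝ)..T, ‖q r n‖) ^ 2, Summable.mul_left _ ?_,
      fun t ht n => ?_⟩
    · refine summable_of_sum_le (c := (1 * Real.exp (1 * T) / 1) ^ 2) (fun _ => sq_nonneg _)
        fun F => ?_
      refine sum_sq_integral_le T.2 zero_lt_one (fun n => (hq n).norm) F fun r hr _ => ?_
      refine (hq1 r F).trans ?_
      have : 1 ≤ Real.exp (1 * r) := Real.one_le_exp (by linarith)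
      nlinarith
    · have hI : ∫ r in (0 : ℝ)..t, ‖q r n‖ ≤ ∫ r in (0 : ℝ)..T, ‖q r n‖ :=
        intervalIntegral.integral_mono_interval le_rfl t.2 (NNReal.coe_le_coe.2 ht)
          (Eventually.of_forall fun r => norm_nonneg _) ((hq n).norm.intervalIntegrable _ _)
      have hI0 : 0 ≤ ∫ r in (0 : ℝ)..t, ‖q r n‖ :=
        intervalIntegral.integral_nonneg t.2 fun r _ => norm_nonneg _
      have hw : 0 < √(1 + (n : ℝ) ^ 2) := Real.sqrt_pos.2 (weight_pos n)
      have h1 := norm_integral_mul_le (k := propagator n) (C := 2 / √(1 + (n : ℝ) ^ 2)) t.2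
        (fun r hr => by
          rw [le_div_iff₀ hw, mul_comm]
          exact abs_propagator_le n hr) (continuous_propagator n) (hq n)
      have h2 := norm_integral_mul_le t.2 (fun r hr => abs_propagator'_le n hr)
        (continuous_propagator' n) (hq n)
      have hle : (1 + (n : ℝ) ^ 2) ^ (σ - 1) ≤ 1 :=
        Real.rpow_le_one_of_one_le_of_nonpos (one_le_weight n) (by linarith)
      refine (mul_le_of_le_one_left (energy_nonneg _ _ _) hle).trans ?_
      have h3 := pow_le_pow_left₀ (norm_nonneg _) h1 2
      have h4 := pow_le_pow_left₀ (norm_nonneg _) h2 2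
      have h5 := pow_le_pow_left₀ hI0 hI 2
      rw [mul_pow, div_pow, Real.sq_sqrt (weight_pos n).le, div_mul_eq_mul_div,
        le_div_iff₀ (weight_pos n)] at h3
      rw [mul_pow] at h4
      simp only [energy, NNReal.val_eq_coe] at *
      linarith

/-! ### Well-posedness -/

/-- Global existence and uniqueness for a Volterra type equation `u = U + N u` by a contraction in
an exponentially weighted space. -/
theorem existsUnique_volterra {E : Type*} [NormedAddCommGroup E] [NormedSpace ℝ E]
    [CompleteSpace E] (N : C(ℝ≥0, E) → C(ℝ≥0, E)) {K C : ℝ}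
    (hbd : ∀ u t, ‖N u t‖ ≤ C * Real.exp (K * t))
    (hlip : ∀ u v M, 0 ≤ M → (∀ t : ℝ≥0, ‖u t - v t‖ ≤ M * Real.exp (K * t)) →
      ∀ t : ℝ≥0, ‖N u t - N v t‖ ≤ 1 / 2 * M * Real.exp (K * t)) (U : C(ℝ≥0, E)) :
    ∃! u : C(ℝ≥0, E), u = U + N u := by
  let ex : C(ℝ≥0, ℝ) := ⟨fun t => Real.exp (K * t), by fun_prop⟩
  let ex' : C(ℝ≥0, ℝ) := ⟨fun t => Real.exp (-(K * t)), by fun_prop⟩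
  have hinv : ∀ t, ex t * ex' t = 1 := fun t => by
    simp only [ex, ex', ContinuousMap.coe_mk, ← Real.exp_add]
    simp
  have hex' : ∀ t, 0 < ex' t := fun t => Real.exp_pos _
  have hex : ∀ t, 0 < ex t := fun t => Real.exp_pos _
  have hbd' : ∀ u t, ‖(ex' • N u : C(ℝ≥0, E)) t‖ ≤ C := fun u t => by
    have h := mul_le_mul_of_nonneg_left (hbd u t) (hex' t).le
    have h1 := hinv t
    simp only [ContinuousMap.smul_apply', norm_smul, Real.norm_of_nonneg (hex' t).le]
    calc ex' t * ‖N u t‖ ≤ ex' t * (C * ex t) := h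
      _ = C * (ex t * ex' t) := by ring
      _ = C := by rw [h1, mul_one]
  -- The unknown is `v = e^{-Kt} N u`, which is bounded by `C`, instead of `u`. Thus no growth
  -- condition on `U` is needed, and every continuous solution arises from such a `v`, which gives
  -- unconditional uniqueness.
  let lift : BoundedContinuousFunction ℝ≥0 E → C(ℝ≥0, E) := fun v => U + ex • v.toContinuousMap
  let G : BoundedContinuousFunction ℝ≥0 E → BoundedContinuousFunction ℝ≥0 E := fun v =>
    BoundedContinuousFunction.ofNormedAddCommGroup (ex' • N (lift v) : C(ℝ≥0, E))
      (ContinuousMap.continuous _) C (hbd' _)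
  have hG : ∀ v t, G v t = ex' t • N (lift v) t := fun v t => rfl
  have hcontr : ContractingWith (1 / 2) G := by
    refine ⟨by norm_num, LipschitzWith.of_dist_le_mul fun v w => ?_⟩
    rw [BoundedContinuousFunction.dist_le (by positivity)]
    intro t
    rw [hG, hG, dist_eq_norm, ← smul_sub, norm_smul, Real.norm_of_nonneg (hex' t).le]
    have h := hlip (lift v) (lift w) (dist v w) dist_nonneg (fun r => by
      have h2 : lift v r - lift w r = ex r • (v r - w r) := by
        simp [lift, smul_sub]
      rw [h2, norm_smul, Real.norm_of_nonneg (hex r).le, mul_comm, ← dist_eq_norm]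
      exact mul_le_mul_of_nonneg_right (BoundedContinuousFunction.dist_coe_le_dist r) (hex r).le) t
    have h3 := mul_le_mul_of_nonneg_left h (hex' t).le
    calc _ ≤ ex' t * (1 / 2 * dist v w * ex t) := h3
      _ = 1 / 2 * dist v w * (ex t * ex' t) := by ring
      _ = _ := by rw [hinv t, mul_one]; simp
  have hfix : ∀ v, G v = v → N (lift v) = ex • v.toContinuousMap := fun v hv => by
    ext t
    have h := hG v t
    rw [hv] at h
    simp [h, smul_smul, hinv t]
  refine ⟨lift hcontr.fixedPoint, ?_, fun u hu => ?_⟩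
  · change lift hcontr.fixedPoint = U + N (lift hcontr.fixedPoint)
    rw [hfix _ hcontr.fixedPoint_isFixedPt]
  · let v : BoundedContinuousFunction ℝ≥0 E :=
      BoundedContinuousFunction.ofNormedAddCommGroup (ex' • N u : C(ℝ≥0, E))
        (ContinuousMap.continuous _) C (hbd' u)
    have hv : ∀ t, v t = ex' t • N u t := fun t => rfl
    have hl : lift v = u := by
      ext t
      have h := congrArg (fun f : C(ℝ≥0, E) => f t) hu
      simp only [ContinuousMap.add_apply] at h
      rw [h]
      simp [lift, hv, smul_smul, hinv t]
    have hGv : G v = v := by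
      ext t
      rw [hG, hl, hv]
    rw [← hl, hcontr.fixedPoint_unique hGv]

theorem convolution_sub {k : ℝ → ℝ} {q q' : ℝ → ℂ} (hk : Continuous k) (hq : Continuous q)
    (hq' : Continuous q') (t : ℝ) :
    (∫ r in (0 : ℝ)..t, (k (t - r) : ℂ) * q r) - ∫ r in (0 : ℝ)..t, (k (t - r) : ℂ) * q' r
      = ∫ r in (0 : ℝ)..t, (k (t - r) : ℂ) * (q r - q' r) := by
  rw [← intervalIntegral.integral_sub (Continuous.intervalIntegrable (by fun_prop) _ _)
    (Continuous.intervalIntegrable (by fun_prop) _ _)]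
  simp only [mul_sub]

/-- The Duhamel integral of the nonlinearity along a path in `ℓ²`. -/
theorem exists_duhamelMap (β : ℝ) : ∃ N : C(ℝ≥0, EllTwo) → C(ℝ≥0, EllTwo),
    (∀ u t n, N u t n =
      ∫ r in (0 : ℝ)..t, (propagator n (t - r) : ℂ) * sinCoeff β (u r.toNNReal) n) ∧
    (∀ K, 0 < K → ∀ u t, ‖N u t‖ ≤ 2 / K * Real.exp (K * t)) ∧
    ∀ K, 0 < K → ∀ u v M, 0 ≤ M → (∀ t : ℝ≥0, ‖u t - v t‖ ≤ M * Real.exp (K * t)) →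
      ∀ t : ℝ≥0, ‖N u t - N v t‖ ≤ 2 * |β| / K * M * Real.exp (K * t) := by
  obtain ⟨S, hS, hS1, hSlip⟩ := exists_sinMap β
  have hScont : Continuous S := by
    refine (LipschitzWith.of_dist_le_mul (K := ⟨|β|, abs_nonneg β⟩) fun a b => ?_).continuous
    rw [dist_eq_norm, dist_eq_norm]
    exact hSlip a b
  have hSc : ∀ (u : C(ℝ≥0, EllTwo)) n, Continuous fun r : ℝ => S (u r.toNNReal) n := fun u n =>
    (EllTwo.continuous_apply n).comp (hScont.comp (u.continuous.comp continuous_real_toNNReal))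
  have hpath : ∀ u : C(ℝ≥0, EllTwo), IsPhasePath 1
      (fun t n => ∫ r in (0 : ℝ)..t, (propagator n (t - r) : ℂ) * S (u r.toNNReal) n)
      (fun t n => ∫ r in (0 : ℝ)..t, (propagator' n (t - r) : ℂ) * S (u r.toNNReal) n) :=
    fun u => isPhasePath_duhamel le_rfl (hSc u) fun r F =>
      (EllTwo.sum_norm_sq_le _ F).trans (pow_le_one₀ (norm_nonneg _) (hS1 _))
  choose N hN using fun u => (hpath u).exists_continuousMap_ellTwo zero_le_one
  refine ⟨N, fun u t n => by simp only [hN, hS], fun K hK u t => ?_, fun K hK u v M hM huv t => ?_⟩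
  · refine EllTwo.norm_le_of_forall_sum_le (by positivity) fun F => ?_
    calc ∑ n ∈ F, ‖N u t n‖ ^ 2
        ≤ ∑ n ∈ F, 2 ^ 2 * (∫ r in (0 : ℝ)..t, ‖S (u r.toNNReal) n‖) ^ 2 := by
          refine Finset.sum_le_sum fun n _ => ?_
          rw [hN, ← mul_pow]
          exact pow_le_pow_left₀ (norm_nonneg _) (norm_integral_mul_le t.2
            (fun r hr => abs_propagator_le_two n hr) (continuous_propagator n) (hSc u n)) 2
      _ = 2 ^ 2 * ∑ n ∈ F, (∫ r in (0 : ℝ)..t, ‖S (u r.toNNReal) n‖) ^ 2 := by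
          rw [Finset.mul_sum]
      _ ≤ 2 ^ 2 * (1 * Real.exp (K * t) / K) ^ 2 := by
          refine mul_le_mul_of_nonneg_left ?_ (by norm_num)
          refine sum_sq_integral_le t.2 hK (fun n => (hSc u n).norm) F fun r hr _ => ?_
          refine (EllTwo.sum_norm_sq_le _ F).trans ?_
          have h1 : 1 ≤ Real.exp (K * r) := Real.one_le_exp (by positivity)
          nlinarith [hS1 (u r.toNNReal), norm_nonneg (S (u r.toNNReal))]
      _ = (2 / K * Real.exp (K * t)) ^ 2 := by ring
  · refine EllTwo.norm_le_of_forall_sum_le (by positivity) fun F => ?_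
    have hd : ∀ n, Continuous fun r : ℝ => S (u r.toNNReal) n - S (v r.toNNReal) n := fun n =>
      (hSc u n).sub (hSc v n)
    calc ∑ n ∈ F, ‖(N u t - N v t) n‖ ^ 2
        ≤ ∑ n ∈ F, 2 ^ 2 * (∫ r in (0 : ℝ)..t, ‖S (u r.toNNReal) n - S (v r.toNNReal) n‖) ^ 2 := by
          refine Finset.sum_le_sum fun n _ => ?_
          have hsub : (N u t - N v t) n = ∫ r in (0 : ℝ)..t,
              (propagator n (t - r) : ℂ) * (S (u r.toNNReal) n - S (v r.toNNReal) n) := by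
            refine Eq.trans ?_ (convolution_sub (continuous_propagator n) (hSc u n) (hSc v n) t)
            rw [← hN, ← hN]
            rfl
          rw [hsub, ← mul_pow]
          exact pow_le_pow_left₀ (norm_nonneg _) (norm_integral_mul_le t.2
            (fun r hr => abs_propagator_le_two n hr) (continuous_propagator n) (hd n)) 2
      _ = 2 ^ 2 * ∑ n ∈ F,
            (∫ r in (0 : ℝ)..t, ‖S (u r.toNNReal) n - S (v r.toNNReal) n‖) ^ 2 := by
          rw [Finset.mul_sum]
      _ ≤ 2 ^ 2 * ((|β| * M) * Real.exp (K * t) / K) ^ 2 := by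
          refine mul_le_mul_of_nonneg_left ?_ (by norm_num)
          refine sum_sq_integral_le t.2 hK (fun n => (hd n).norm) F fun r hr _ => ?_
          refine (EllTwo.sum_norm_sq_le (S (u r.toNNReal) - S (v r.toNNReal)) F).trans ?_
          rw [← mul_pow]
          refine pow_le_pow_left₀ (norm_nonneg _) ((hSlip _ _).trans ?_) 2
          have h := huv r.toNNReal
          rw [Real.coe_toNNReal r hr] at h
          rw [mul_assoc]
          exact mul_le_mul_of_nonneg_left h (abs_nonneg _)
      _ = (2 * |β| / K * M * Real.exp (K * t)) ^ 2 := by ring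

theorem conj_convolution {k k' : ℝ → ℝ} (hk : k' = k) {q q' : ℝ → ℂ} (hq : ∀ r, q' r = conj (q r))
    (t : ℝ) : ∫ r in (0 : ℝ)..t, (k' (t - r) : ℂ) * q' r
      = conj (∫ r in (0 : ℝ)..t, (k (t - r) : ℂ) * q r) := by
  subst hk
  simp [intervalIntegral, hq, ← integral_conj]


theorem isPhasePath_duhamel_sin {σ : ℝ} (hσ : σ ≤ 1) (β : ℝ) (u : C(ℝ≥0, EllTwo)) :
    IsPhasePath σ
      (fun t n => ∫ r in (0 : ℝ)..t, (propagator n (t - r) : ℂ) * sinCoeff β (u r.toNNReal) n)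
      (fun t n => ∫ r in (0 : ℝ)..t, (propagator' n (t - r) : ℂ) * sinCoeff β (u r.toNNReal) n) := by
  obtain ⟨S, hS, hS1, hSlip⟩ := exists_sinMap β
  have hScont : Continuous S := by
    refine (LipschitzWith.of_dist_le_mul (K := ⟨|β|, abs_nonneg β⟩) fun a b => ?_).continuous
    rw [dist_eq_norm, dist_eq_norm]
    exact hSlip a b
  simp only [← hS]
  refine isPhasePath_duhamel hσ (fun n => (EllTwo.continuous_apply n).comp
    (hScont.comp (u.continuous.comp continuous_real_toNNReal))) fun r F => ?_
  exact (EllTwo.sum_norm_sq_le _ F).trans (pow_le_one₀ (norm_nonneg _) (hS1 _))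

/-- The position of a path in phase space, as a path in `ℓ²`. -/
theorem exists_position {s : ℝ} (hs : 0 ≤ s) (Φ : C(ℝ≥0, Phase s)) :
    ∃ u : C(ℝ≥0, EllTwo), ∀ t, (u t : ℤ → ℂ) = (Φ t).1.coeff := by
  obtain ⟨J, hJ⟩ := Sobolev.exists_continuousMap_ellTwo hs
  exact ⟨⟨fun t => J (Φ t).1, J.continuous.comp (continuous_fst.comp Φ.continuous)⟩,
    fun t => funext (hJ _)⟩

/-- Global well-posedness in `𝓗^s` of the Duhamel formulation with a given linear part. -/
theorem existsUnique_mild {s : ℝ} (hs : 0 ≤ s) (hs1 : s ≤ 1) (γ β : ℝ) {p v : ℝ≥0 → ℤ → ℂ}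
    (hpv : IsPhasePath s p v) (hp : ∀ t n, p t (-n) = conj (p t n))
    (hv : ∀ t n, v t (-n) = conj (v t n)) :
    ∃! Φ : C(ℝ≥0, Phase s), ∀ t n,
      (Φ t).1.coeff n = p t n - γ * ∫ r in (0 : ℝ)..t,
        (propagator n (t - r) : ℂ) * sinCoeff β (Φ r.toNNReal).1.coeff n ∧
      (Φ t).2.coeff n = v t n - γ * ∫ r in (0 : ℝ)..t,
        (propagator' n (t - r) : ℂ) * sinCoeff β (Φ r.toNNReal).1.coeff n := by
  obtain ⟨U, hU⟩ := hpv.exists_continuousMap_ellTwo hs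
  obtain ⟨N, hN, hNbd, hNlip⟩ := exists_duhamelMap β
  -- The weight is chosen so that `|γ| * (2|β| / K) ≤ 1/2`. The fixed point problem concerns the
  -- position only, since the nonlinearity does not see the velocity; the velocity is then given by
  -- its own formula.
  have hK : 0 < 4 * |γ| * |β| + 1 := by positivity
  obtain ⟨u, hu, huu⟩ := existsUnique_volterra (fun w => (-γ) • N w)
    (K := 4 * |γ| * |β| + 1) (C := |γ| * (2 / (4 * |γ| * |β| + 1)))
    (fun w t => by
      rw [ContinuousMap.smul_apply, norm_smul, norm_neg, Real.norm_eq_abs, mul_assoc]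
      exact mul_le_mul_of_nonneg_left (hNbd _ hK w t) (abs_nonneg _))
    (fun w w' M hM h t => by
      rw [ContinuousMap.smul_apply, ContinuousMap.smul_apply, ← smul_sub, norm_smul, norm_neg,
        Real.norm_eq_abs]
      refine (mul_le_mul_of_nonneg_left (hNlip _ hK w w' M hM h t) (abs_nonneg _)).trans ?_
      rw [← mul_assoc, ← mul_assoc]
      refine mul_le_mul_of_nonneg_right (mul_le_mul_of_nonneg_right ?_ hM) (Real.exp_pos _).le
      rw [← mul_div_assoc, div_le_iff₀ hK]
      nlinarith [abs_nonneg γ, abs_nonneg β]) U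
  have hu' : ∀ w : C(ℝ≥0, EllTwo), w = U + (-γ) • N w ↔ ∀ t n, w t n = p t n - γ *
      ∫ r in (0 : ℝ)..t, (propagator n (t - r) : ℂ) * sinCoeff β (w r.toNNReal) n := by
    intro w
    have he : ∀ t n, (U + (-γ) • N w) t n = p t n - γ *
        ∫ r in (0 : ℝ)..t, (propagator n (t - r) : ℂ) * sinCoeff β (w r.toNNReal) n := by
      intro t n
      rw [← hN, ← hU]
      change U t n + (-γ) • N w t n = _
      rw [Complex.real_smul]
      push_cast
      ring
    constructor
    · intro h t n
      rw [← he, ← h]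
    · intro h
      ext t n
      rw [h, he]
  have hpath := hpv.add ((isPhasePath_duhamel_sin hs1 β u).const_mul (-γ))
  obtain ⟨Φ, hΦ⟩ := hpath.exists_continuousMap
    (fun t n => by
      rw [hp, conj_convolution (propagator_neg n) (fun r => sinCoeff_neg β _ n)]
      simp)
    (fun t n => by
      rw [hv, conj_convolution (propagator'_neg n) (fun r => sinCoeff_neg β _ n)]
      simp)
  have hΦu : ∀ t, (Φ t).1.coeff = u t := fun t => funext fun n => by
    rw [(hΦ t n).1, (hu' u).1 hu t n]
    ring
  refine ⟨Φ, fun t n => ?_, fun Ψ hΨ => ?_⟩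
  · simp only [hΦu]
    rw [← hΦu, (hΦ t n).1, (hΦ t n).2]
    exact ⟨by ring, by ring⟩
  · obtain ⟨w, hw⟩ := exists_position hs Ψ
    have hwu : w = u := huu w ((hu' w).2 fun t n => by
      simp only [hw]
      exact (hΨ t n).1)
    have h1 : ∀ t, (Ψ t).1.coeff = u t := fun t => by rw [← hw, hwu]
    ext t : 1
    refine Prod.ext (Sobolev.ext_coeff fun n => ?_) (Sobolev.ext_coeff fun n => ?_)
    · rw [h1, hΦu]
    · rw [(hΨ t n).2, (hΦ t n).2]
      simp only [h1]
      ring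

/-! ### Doob's maximal inequality for sums of independent random variables -/

/-- The running maximum of the partial sums of a sequence. -/
noncomputable def runMax (x : ℕ → ℝ) : ℕ → ℝ
  | 0 => 0
  | n + 1 => max (runMax x n) (∑ i ∈ Finset.range (n + 1), x i)

theorem runMax_congr {x y : ℕ → ℝ} {n : ℕ} (h : ∀ i < n, x i = y i) : runMax x n = runMax y n := by
  induction n with
  | zero => rfl
  | succ n ih =>
    rw [runMax, runMax, ih fun i hi => h i (by omega),
      Finset.sum_congr rfl fun i hi => h i (Finset.mem_range.1 hi)]

theorem measurable_runMax (n : ℕ) : Measurable fun x : ℕ → ℝ => runMax x n := by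
  induction n with
  | zero => exact measurable_const
  | succ n ih => exact ih.max (by fun_prop)

theorem runMax_mono (x : ℕ → ℝ) : Monotone (runMax x) :=
  monotone_nat_of_le_succ fun _ => le_max_left _ _

theorem sum_le_runMax (x : ℕ → ℝ) (n : ℕ) : ∑ i ∈ Finset.range n, x i ≤ runMax x n := by
  cases n with
  | zero => simp [runMax]
  | succ n => exact le_max_right _ _

theorem runMax_nonneg (x : ℕ → ℝ) (n : ℕ) : 0 ≤ runMax x n := runMax_mono x (Nat.zero_le n)

/-- A pathwise form of Doob's inequality. -/
theorem runMax_sq_le (x : ℕ → ℝ) (n : ℕ) : runMax x n ^ 2 ≤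
    4 * (∑ i ∈ Finset.range n, x i) ^ 2 - 4 * ∑ i ∈ Finset.range n, runMax x i * x i := by
  -- Summation by parts: the maximum `M` increases only at steps where the new partial sum equals
  -- the new maximum, and there `M' (M' - M) ≥ (M'² - M²) / 2`.
  have key : ∑ i ∈ Finset.range n, runMax x i * x i
      ≤ runMax x n * (∑ i ∈ Finset.range n, x i) - runMax x n ^ 2 / 2 := by
    induction n with
    | zero => simp [runMax]
    | succ n ih =>
      rw [Finset.sum_range_succ, runMax]
      rcases le_total (∑ i ∈ Finset.range (n + 1), x i) (runMax x n) with h | h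
      · rw [max_eq_left h, Finset.sum_range_succ]
        linarith
      · rw [max_eq_right h]
        rw [Finset.sum_range_succ] at h ⊢
        nlinarith [sq_nonneg (∑ i ∈ Finset.range n, x i + x n - runMax x n)]
  -- With `S` the partial sum, `4S² - 4MS + 2M² = (2S - M)² + M²`.
  nlinarith [sq_nonneg (2 * (∑ i ∈ Finset.range n, x i) - runMax x n)]

/-- The running maximum controls partial sums from above only, so negative sums are handled by
passing to `-x`. -/
theorem sq_sum_le_runMax (x : ℕ → ℝ) {k n : ℕ} (h : k ≤ n) :
    (∑ i ∈ Finset.range k, x i) ^ 2 ≤ runMax x n ^ 2 + runMax (-x) n ^ 2 := by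
  have h1 := (sum_le_runMax x k).trans (runMax_mono x h)
  have h2 := (sum_le_runMax (-x) k).trans (runMax_mono (-x) h)
  have h3 := runMax_nonneg x n
  have h4 := runMax_nonneg (-x) n
  simp only [Pi.neg_apply, Finset.sum_neg_distrib] at h2
  rcases le_total 0 (∑ i ∈ Finset.range k, x i) with h0 | h0 <;> nlinarith

section

variable {Ω : Type*} [MeasurableSpace Ω] {P : Measure Ω} {X : ℕ → Ω → ℝ}

theorem indepFun_of_past (hX : iIndepFun X P) (hm : ∀ i, AEMeasurable (X i) P) (n : ℕ)
    {g : (ℕ → ℝ) → ℝ} (hg : Measurable g) (hgn : ∀ x y : ℕ → ℝ, (∀ i < n, x i = y i) → g x = g y) :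
    IndepFun (fun ω => g fun i => X i ω) (X n) P := by
  have h := hX.indepFun_finset₀ (Finset.range n) {n} (by simp) hm
  -- Extension by zero turns the first `n` values into a sequence; by `hgn` the values from `n` on
  -- do not affect `g`.
  let e : (Finset.range n → ℝ) → ℕ → ℝ := fun y i => if hi : i ∈ Finset.range n then y ⟨i, hi⟩ else 0
  have he : Measurable e := measurable_pi_lambda _ fun i => by
    by_cases hi : i ∈ Finset.range n
    · simp only [e, hi, dif_pos]
      exact measurable_pi_apply _
    · simp only [e, hi, dif_neg, not_false_eq_true]
      exact measurable_const
  have hψ : Measurable fun y : ({n} : Finset ℕ) → ℝ => y ⟨n, Finset.mem_singleton_self n⟩ :=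
    measurable_pi_apply _
  have h2 := h.comp (hg.comp he) hψ
  refine h2.congr (Eventually.of_forall fun ω => hgn _ _ fun i hi => ?_) (Eventually.of_forall
    fun ω => rfl)
  simp [e, hi]

theorem memLp_runMax (hX : ∀ i, MemLp (X i) 2 P) (n : ℕ) :
    MemLp (fun ω => runMax (fun i => X i ω) n) 2 P := by
  induction n with
  | zero => exact MemLp.zero
  | succ n ih => exact ih.sup (memLp_finsetSum _ fun i _ => hX i)

/-- A factor depending only on the past is independent of the next centred variable. This removes
both the cross terms in the variance of a sum and the correction term of `runMax_sq_le`. -/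
theorem integral_past_mul_eq_zero (hX : iIndepFun X P) (hL : ∀ i, MemLp (X i) 2 P)
    (h0 : ∀ i, ∫ ω, X i ω ∂P = 0) (n : ℕ) {g : (ℕ → ℝ) → ℝ} (hg : Measurable g)
    (hgn : ∀ x y : ℕ → ℝ, (∀ i < n, x i = y i) → g x = g y) :
    ∫ ω, g (fun i => X i ω) * X n ω ∂P = 0 := by
  have hm : ∀ i, AEMeasurable (X i) P := fun i => (hL i).1.aemeasurable
  rw [(indepFun_of_past hX hm n hg hgn).integral_fun_mul_eq_mul_integral
    (hg.comp_aemeasurable (aemeasurable_pi_lambda _ hm)).aestronglyMeasurable (hL n).1, h0,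
    mul_zero]

theorem integral_sq_sum_eq (hX : iIndepFun X P) (hL : ∀ i, MemLp (X i) 2 P)
    (h0 : ∀ i, ∫ ω, X i ω ∂P = 0) (n : ℕ) :
    ∫ ω, (∑ i ∈ Finset.range n, X i ω) ^ 2 ∂P = ∑ i ∈ Finset.range n, ∫ ω, X i ω ^ 2 ∂P := by
  induction n with
  | zero => simp
  | succ n ih =>
    have hS : MemLp (fun ω => ∑ i ∈ Finset.range n, X i ω) 2 P := memLp_finsetSum _ fun i _ => hL i
    have hz := integral_past_mul_eq_zero hX hL h0 n
      (g := fun x => ∑ i ∈ Finset.range n, x i) (by fun_prop)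
      fun x y h => Finset.sum_congr rfl fun i hi => h i (Finset.mem_range.1 hi)
    have h1 : Integrable (fun ω => (∑ i ∈ Finset.range n, X i ω) ^ 2) P := hS.integrable_sq
    have h2 : Integrable (fun ω => X n ω ^ 2) P := (hL n).integrable_sq
    have h3 : Integrable (fun ω => (∑ i ∈ Finset.range n, X i ω) * X n ω) P :=
      hS.integrable_mul (hL n)
    rw [Finset.sum_range_succ, ← ih]
    simp only [Finset.sum_range_succ, add_sq, mul_assoc]
    have h4 : Integrable (fun ω => (∑ i ∈ Finset.range n, X i ω) ^ 2 +
        2 * ((∑ i ∈ Finset.range n, X i ω) * X n ω)) P := h1.add (h3.const_mul 2)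
    rw [integral_add h4 h2, integral_add h1 (h3.const_mul 2), integral_const_mul, hz, mul_zero,
      add_zero]

theorem integral_runMax_sq_le (hX : iIndepFun X P) (hL : ∀ i, MemLp (X i) 2 P)
    (h0 : ∀ i, ∫ ω, X i ω ∂P = 0) (n : ℕ) :
    ∫ ω, runMax (fun i => X i ω) n ^ 2 ∂P ≤ 4 * ∑ i ∈ Finset.range n, ∫ ω, X i ω ^ 2 ∂P := by
  have hS : MemLp (fun ω => ∑ i ∈ Finset.range n, X i ω) 2 P := memLp_finsetSum _ fun i _ => hL i
  have h1 : Integrable (fun ω => (∑ i ∈ Finset.range n, X i ω) ^ 2) P := hS.integrable_sq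
  have h2 : ∀ i, Integrable (fun ω => runMax (fun i => X i ω) i * X i ω) P := fun i =>
    (memLp_runMax hL i).integrable_mul (hL i)
  have h3 : Integrable (fun ω => ∑ i ∈ Finset.range n, runMax (fun i => X i ω) i * X i ω) P :=
    integrable_finsetSum _ fun i _ => h2 i
  calc ∫ ω, runMax (fun i => X i ω) n ^ 2 ∂P
      ≤ ∫ ω, (4 * (∑ i ∈ Finset.range n, X i ω) ^ 2
          - 4 * ∑ i ∈ Finset.range n, runMax (fun i => X i ω) i * X i ω) ∂P :=
        integral_mono (memLp_runMax hL n).integrable_sq ((h1.const_mul 4).sub (h3.const_mul 4))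
          fun ω => runMax_sq_le _ n
    _ = 4 * ∑ i ∈ Finset.range n, ∫ ω, X i ω ^ 2 ∂P := by
        rw [integral_sub (h1.const_mul 4) (h3.const_mul 4), integral_const_mul, integral_const_mul,
          integral_sq_sum_eq hX hL h0, integral_finsetSum _ fun i _ => h2 i,
          Finset.sum_eq_zero fun i _ => integral_past_mul_eq_zero hX hL h0 i (measurable_runMax i)
            fun x y h => runMax_congr h]
        ring

/-- The constant `8 = 4 + 4` comes from the running maxima of `X` and of `-X`. -/
theorem exists_maximal_sum (hX : iIndepFun X P) (hL : ∀ i, MemLp (X i) 2 P)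
    (h0 : ∀ i, ∫ ω, X i ω ∂P = 0) (n : ℕ) : ∃ Y : Ω → ℝ, Integrable Y P ∧ (∀ ω, 0 ≤ Y ω) ∧
      (∀ ω, ∀ k ≤ n, (∑ i ∈ Finset.range k, X i ω) ^ 2 ≤ Y ω) ∧
      ∫ ω, Y ω ∂P ≤ 8 * ∑ i ∈ Finset.range n, ∫ ω, X i ω ^ 2 ∂P := by
  have hX' : iIndepFun (fun i ω => -X i ω) P := hX.comp (fun _ x => -x) fun _ => measurable_neg
  have hL' : ∀ i, MemLp (fun ω => -X i ω) 2 P := fun i => (hL i).neg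
  have h0' : ∀ i, ∫ ω, -X i ω ∂P = 0 := fun i => by rw [integral_neg, h0, neg_zero]
  have i1 := (memLp_runMax hL n).integrable_sq
  have i2 := (memLp_runMax hL' n).integrable_sq
  refine ⟨fun ω => runMax (fun i => X i ω) n ^ 2 + runMax (fun i => -X i ω) n ^ 2, i1.add i2,
    fun ω => by positivity, fun ω k hk => sq_sum_le_runMax (fun i => X i ω) hk, ?_⟩
  rw [integral_add i1 i2]
  have e1 := integral_runMax_sq_le hX hL h0 n
  have e2 := integral_runMax_sq_le hX' hL' h0' n
  simp only [neg_sq] at e2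
  linarith

/-- Maximal inequality for discrete Wiener integrals. -/
theorem exists_maximal_brownian {B : ℝ≥0 → Ω → ℝ} (hB : IsPreBrownianReal B P) (h : ℝ≥0) (n : ℕ)
    {g : ℕ → ℝ} {G : ℝ} (hg : ∀ i < n, |g i| ≤ G) :
    ∃ Y : Ω → ℝ, Integrable Y P ∧ (∀ ω, 0 ≤ Y ω) ∧
      (∀ ω, ∀ k ≤ n, (∑ i ∈ Finset.range k,
        g i * (B ((i + 1 : ℕ) * h) ω - B (i * h) ω)) ^ 2 ≤ Y ω) ∧
      ∫ ω, Y ω ∂P ≤ 8 * (G ^ 2 * (n * h)) := by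
  have ht : Monotone fun i : ℕ => (i : ℝ≥0) * h := fun i j hij =>
    mul_le_mul_left (Nat.cast_le.2 hij) h
  have hI := (hB.hasIndepIncrements.nat ht).comp (fun i x => g i * x) fun i =>
    measurable_const.mul measurable_id
  have hlaw : ∀ i : ℕ, HasLaw (fun ω => B ((i + 1 : ℕ) * h) ω - B (i * h) ω)
      (gaussianReal 0 h) P := fun i => by
    have hl := hB.hasLaw_sub ((i + 1 : ℕ) * h) (i * h)
    have hn : nndist (((i + 1 : ℕ) * h : ℝ≥0) : ℝ) ((i * h : ℝ≥0) : ℝ) = h := by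
      rw [← NNReal.coe_inj, coe_nndist, Real.dist_eq]
      push_cast
      rw [show ((i : ℝ) + 1) * h - i * h = h by ring, NNReal.abs_eq]
    simp only [NNReal.val_eq_coe] at hl
    rwa [hn] at hl
  have hL : ∀ i : ℕ, MemLp (fun ω => B ((i + 1 : ℕ) * h) ω - B (i * h) ω) 2 P := fun i =>
    (hlaw i).hasGaussianLaw.memLp_two
  have h0 : ∀ i : ℕ, ∫ ω, (B ((i + 1 : ℕ) * h) ω - B (i * h) ω) ∂P = 0 := fun i => by
    rw [(hlaw i).integral_eq, integral_id_gaussianReal]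
  have hsq : ∀ i : ℕ, ∫ ω, (B ((i + 1 : ℕ) * h) ω - B (i * h) ω) ^ 2 ∂P = h := fun i => by
    have hp := hB.isGaussianProcess.isProbabilityMeasure
    have hv := (hlaw i).variance_eq
    rw [variance_of_integral_eq_zero (hL i).1.aemeasurable (h0 i), variance_id_gaussianReal] at hv
    exact hv
  obtain ⟨Y, hY, hY0, hYk, hYi⟩ := exists_maximal_sum hI (fun i => (hL i).const_mul (g i))
    (fun i => by
      simp only [Function.comp_def]
      rw [integral_const_mul, h0, mul_zero]) n
  refine ⟨Y, hY, hY0, hYk, hYi.trans ?_⟩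
  refine mul_le_mul_of_nonneg_left ?_ (by norm_num)
  simp only [Function.comp_def, mul_pow, integral_const_mul, hsq]
  have hs := Finset.sum_le_sum (s := Finset.range n) (f := fun i => g i ^ 2 * (h : ℝ))
    (g := fun _ => G ^ 2 * (h : ℝ)) fun i hi => by
      refine mul_le_mul_of_nonneg_right ?_ h.2
      exact sq_le_sq' (by linarith [neg_abs_le (g i), hg i (Finset.mem_range.1 hi)])
        ((le_abs_self _).trans (hg i (Finset.mem_range.1 hi)))
  refine hs.trans (le_of_eq ?_)
  rw [Finset.sum_const, Finset.card_range, nsmul_eq_mul]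
  ring

end

/-! ### Wiener integrals -/

section

variable {g : ℝ → ℝ} {w : ℝ≥0 → ℂ}

theorem continuous_wienerIntegrand (hg : ContDiff ℝ 1 g) (hw : Continuous w) :
    Continuous fun r : ℝ => ((deriv g r : ℝ) : ℂ) * w r.toNNReal := by
  have h1 := hg.continuous_deriv le_rfl
  have h2 := hw.comp continuous_real_toNNReal
  simp only [Function.comp_def] at h2
  fun_prop

theorem continuous_wienerIntegral (hg : ContDiff ℝ 1 g) (hw : Continuous w) :
    Continuous (wienerIntegral g w) := by
  have h1 : Continuous fun t : ℝ => ∫ r in (0 : ℝ)..t, ((deriv g r : ℝ) : ℂ) * w r.toNNReal :=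
    intervalIntegral.continuous_primitive
      (fun _ _ => (continuous_wienerIntegrand hg hw).intervalIntegrable _ _) 0
  have h2 := h1.comp NNReal.continuous_coe
  have h3 := hg.continuous.comp NNReal.continuous_coe
  simp only [Function.comp_def] at h2 h3
  unfold wienerIntegral
  fun_prop

/-- Integration by parts on one cell of a Riemann sum. The right side shows the cell error to be the
cell length times `sup |g'|` times the oscillation of `w`, so errors summed over a grid vanish by
uniform continuity of the path. -/
theorem wienerIntegral_sub_eq (hg : ContDiff ℝ 1 g) (hw : Continuous w) (a b : ℝ≥0) :
    wienerIntegral g w b - wienerIntegral g w a - g a * (w b - w a)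
      = ∫ r in (a : ℝ)..b, ((deriv g r : ℝ) : ℂ) * (w b - w r.toNNReal) := by
  have hc := continuous_wienerIntegrand hg hw
  have hd := hg.continuous_deriv le_rfl
  have h1 : (∫ r in (0 : ℝ)..b, ((deriv g r : ℝ) : ℂ) * w r.toNNReal)
      - ∫ r in (0 : ℝ)..a, ((deriv g r : ℝ) : ℂ) * w r.toNNReal
      = ∫ r in (a : ℝ)..b, ((deriv g r : ℝ) : ℂ) * w r.toNNReal :=
    intervalIntegral.integral_interval_sub_left (hc.intervalIntegrable _ _)
      (hc.intervalIntegrable _ _)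
  have h2 : ∫ r in (a : ℝ)..b, ((deriv g r : ℝ) : ℂ) * w b = (g b - g a) * w b := by
    rw [intervalIntegral.integral_mul_const, intervalIntegral.integral_ofReal,
      intervalIntegral.integral_deriv_eq_sub
        (fun x _ => (hg.differentiable one_ne_zero).differentiableAt)
        (hd.intervalIntegrable _ _)]
    push_cast
    rfl
  simp only [mul_sub]
  rw [intervalIntegral.integral_sub (Continuous.intervalIntegrable (by fun_prop) _ _)
    (hc.intervalIntegrable _ _), h2, ← h1]
  unfold wienerIntegral
  ring

theorem norm_wienerIntegral_sub_sum_le (hg : ContDiff ℝ 1 g) (hw : Continuous w) {h : ℝ≥0} {k : ℕ}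
    {D ε : ℝ} (hD : ∀ r : ℝ, 0 ≤ r → r ≤ k * h → |deriv g r| ≤ D)
    (hε : ∀ j < k, ∀ r : ℝ≥0, j * h ≤ r → r ≤ (j + 1 : ℕ) * h → ‖w ((j + 1 : ℕ) * h) - w r‖ ≤ ε) :
    ‖wienerIntegral g w (k * h) -
      ∑ i ∈ Finset.range k, ((g (i * h) : ℝ) : ℂ) * (w ((i + 1 : ℕ) * h) - w (i * h))‖
        ≤ D * ε * (k * h) := by
  induction k with
  | zero => simp [wienerIntegral]
  | succ k ih =>
    have hle : ((k : ℝ≥0) * h) ≤ (k + 1 : ℕ) * h := by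
      gcongr
      exact_mod_cast Nat.le_succ k
    have hle' : (k : ℝ) * h ≤ (k + 1 : ℕ) * h := by exact_mod_cast hle
    have ih := ih (fun r hr hr' => hD r hr (hr'.trans hle')) fun j hj => hε j (by omega)
    have hinc := wienerIntegral_sub_eq hg hw (k * h) ((k + 1 : ℕ) * h)
    have hbd : ‖∫ r in ((k * h : ℝ≥0) : ℝ)..((k + 1 : ℕ) * h : ℝ≥0),
        ((deriv g r : ℝ) : ℂ) * (w ((k + 1 : ℕ) * h) - w r.toNNReal)‖ ≤ D * ε * h := by
      have hb := intervalIntegral.norm_integral_le_of_norm_le_const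
        (a := ((k * h : ℝ≥0) : ℝ)) (b := ((k + 1 : ℕ) * h : ℝ≥0)) (C := D * ε)
        (f := fun r => ((deriv g r : ℝ) : ℂ) * (w ((k + 1 : ℕ) * h) - w r.toNNReal)) ?_
      · refine hb.trans (le_of_eq ?_)
        congr 1
        push_cast
        rw [show ((k : ℝ) + 1) * h - k * h = h by ring, NNReal.abs_eq]
      · intro r hr
        rw [Set.uIoc_of_le (NNReal.coe_le_coe.2 hle)] at hr
        have hr0 : 0 ≤ r := (NNReal.coe_nonneg _).trans hr.1.le
        have hr1 := hr.1.le
        have hr2 := hr.2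
        have hDr := hD r hr0 (by simpa using hr2)
        rw [norm_mul, Complex.norm_real, Real.norm_eq_abs]
        refine mul_le_mul hDr ?_ (norm_nonneg _) ((abs_nonneg _).trans hDr)
        refine hε k (Nat.lt_succ_self k) _ ?_ ?_
        · rw [← NNReal.coe_le_coe, Real.coe_toNNReal r hr0]
          exact hr1
        · rw [← NNReal.coe_le_coe, Real.coe_toNNReal r hr0]
          exact hr2
    rw [← hinc] at hbd
    rw [Finset.sum_range_succ]
    have hsum := norm_add_le _ _ |>.trans (add_le_add ih hbd)
    have he : D * ε * (k * h) + D * ε * h = D * ε * ((k + 1 : ℕ) * h) := by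
      push_cast
      ring
    rw [he] at hsum
    refine le_trans (le_of_eq ?_) hsum
    congr 1
    push_cast
    ring

/-- Wiener integrals are limits of Riemann sums along uniform grids. -/
theorem tendsto_riemannSum (hg : ContDiff ℝ 1 g) (hw : Continuous w) {t T : ℝ≥0} (htT : t ≤ T)
    (hT : 0 < T) :
    Tendsto (fun N : ℕ => ∑ i ∈ Finset.range ⌊t / (T / (N + 1 : ℕ))⌋₊,
      ((g (i * (T / (N + 1 : ℕ) : ℝ≥0)) : ℝ) : ℂ) *
        (w ((i + 1 : ℕ) * (T / (N + 1 : ℕ))) - w (i * (T / (N + 1 : ℕ))))) atTop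
      (𝓝 (wienerIntegral g w t)) := by
  -- One grid of `[0, T]` serves all `t ≤ T`; a given `t` is replaced by the last grid point `k N *
  -- h N` not exceeding it. The `N + 1` avoids division by zero.
  set h : ℕ → ℝ≥0 := fun N => T / (N + 1 : ℕ) with hh
  set k : ℕ → ℕ := fun N => ⌊t / h N⌋₊ with hk
  have hpos : ∀ N, 0 < h N := fun N => div_pos hT (by positivity)
  have hkt : ∀ N, (k N : ℝ≥0) * h N ≤ t := fun N => by
    rw [← le_div_iff₀ (hpos N)]
    exact Nat.floor_le (zero_le)
  have hkt' : ∀ N, t ≤ (k N : ℝ≥0) * h N + h N := fun N => by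
    have := (Nat.lt_floor_add_one (t / h N)).le
    rw [div_le_iff₀ (hpos N)] at this
    rwa [add_mul, one_mul] at this
  have hlim : Tendsto h atTop (𝓝 0) := by
    have h1 := tendsto_const_div_atTop_nhds_zero_nat (𝕜 := ℝ) (T : ℝ)
    have h2 := (tendsto_add_atTop_iff_nat 1).2 h1
    rw [← NNReal.tendsto_coe]
    simpa [hh] using h2
  have hgrid : Tendsto (fun N => (k N : ℝ≥0) * h N) atTop (𝓝 t) := by
    rw [← NNReal.tendsto_coe] at hlim ⊢
    refine tendsto_of_tendsto_of_tendsto_of_le_of_le (g := fun N => (t : ℝ) - h N)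
      (h := fun _ => (t : ℝ)) ?_ tendsto_const_nhds (fun N => ?_) fun N => ?_
    · simpa using hlim.const_sub (t : ℝ)
    · have := hkt' N
      rw [← NNReal.coe_le_coe, NNReal.coe_add] at this
      simp only
      linarith
    · exact NNReal.coe_le_coe.2 (hkt N)
  have hI := ((continuous_wienerIntegral hg hw).tendsto t).comp hgrid
  obtain ⟨D, hD⟩ := (isCompact_Icc (a := (0 : ℝ)) (b := T)).exists_bound_of_continuousOn
    (hg.continuous_deriv le_rfl).continuousOn
  have hD0 : 0 ≤ D := (norm_nonneg _).trans (hD 0 ⟨le_rfl, T.2⟩)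
  have hdiff : Tendsto (fun N => wienerIntegral g w (k N * h N) -
      ∑ i ∈ Finset.range (k N), ((g (i * h N) : ℝ) : ℂ) *
        (w ((i + 1 : ℕ) * h N) - w (i * h N))) atTop (𝓝 0) := by
    rw [Metric.tendsto_atTop]
    intro ε hε
    have huc := (isCompact_Icc (a := (0 : ℝ≥0)) (b := T)).uniformContinuousOn_of_continuous
      hw.continuousOn
    rw [Metric.uniformContinuousOn_iff] at huc
    have hη : 0 < ε / (D * T + 1) := by positivity
    obtain ⟨δ, hδ, hwδ⟩ := huc _ hη
    obtain ⟨N₀, hN₀⟩ := (Metric.tendsto_atTop.1 hlim) δ hδ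
    refine ⟨N₀, fun N hN => ?_⟩
    have hhN : (h N : ℝ) < δ := by
      have := hN₀ N hN
      rwa [NNReal.dist_eq, NNReal.coe_zero, sub_zero, NNReal.abs_eq] at this
    have hkT : (k N : ℝ≥0) * h N ≤ T := (hkt N).trans htT
    rw [dist_zero_right]
    refine (norm_wienerIntegral_sub_sum_le hg hw (D := D) (ε := ε / (D * T + 1)) (fun r hr hr' =>
      hD r ⟨hr, hr'.trans (by exact_mod_cast hkT)⟩) fun j hj r hr hr' => ?_).trans_lt ?_
    · have hjT : ((j + 1 : ℕ) : ℝ≥0) * h N ≤ T := by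
        refine le_trans ?_ hkT
        gcongr
        exact hj
      rw [← dist_eq_norm]
      refine (hwδ _ ⟨zero_le, hjT⟩ _ ⟨zero_le, hr'.trans hjT⟩ ?_).le
      rw [NNReal.dist_eq, abs_of_nonneg (sub_nonneg.2 (NNReal.coe_le_coe.2 hr'))]
      have := NNReal.coe_le_coe.2 hr
      push_cast at this ⊢
      linarith
    · have hkT' : (k N : ℝ) * h N ≤ T := by exact_mod_cast hkT
      have h1 : D * (ε / (D * T + 1)) * (k N * h N) ≤ D * (ε / (D * T + 1)) * T :=
        mul_le_mul_of_nonneg_left hkT' (by positivity)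
      refine h1.trans_lt ?_
      have hpos' : (0 : ℝ) < D * T + 1 := by positivity
      rw [mul_div_assoc', div_mul_eq_mul_div, div_lt_iff₀ hpos']
      nlinarith
  have hres := hI.sub hdiff
  rw [sub_zero] at hres
  refine hres.congr fun N => ?_
  simp only [Function.comp_def, sub_sub_cancel]
  rfl

end

/-! ### Maximal inequalities for the modes of the noise -/

section

variable {Ω : Type*} [MeasurableSpace Ω] {P : Measure Ω} {W : ℤ → ℝ≥0 → Ω → ℂ}

/-- The factors are `±1/√2` for `n ≠ 0`, and `1` and `0` for `n = 0`, where conjugation symmetry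
kills the imaginary part. Estimates on real Brownian motions thereby transfer to all modes. -/
theorem IsCylindricalWiener.exists_re_im (hW : IsCylindricalWiener W P) (n : ℤ) :
    (∃ (c : ℝ) (k : ℤ), c ^ 2 ≤ 1 ∧ ∀ t ω, (W n t ω).re = c * realComponent W k t ω) ∧
    ∃ (c : ℝ) (k : ℤ), c ^ 2 ≤ 1 ∧ ∀ t ω, (W n t ω).im = c * realComponent W k t ω := by
  have h2 : (√2 : ℝ) ≠ 0 := by positivity
  have hc : ((√2 : ℝ)⁻¹) ^ 2 ≤ 1 := by
    rw [inv_pow, Real.sq_sqrt (by norm_num)]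
    norm_num
  rcases lt_trichotomy n 0 with hn | rfl | hn
  · have hconj : ∀ t ω, W n t ω = conj (W (-n) t ω) := fun t ω => by
      rw [← hW.conj_symm, neg_neg]
    refine ⟨⟨(√2)⁻¹, -n, hc, fun t ω => ?_⟩, ⟨-(√2)⁻¹, n, by simpa using hc, fun t ω => ?_⟩⟩
    · have h3 : -n ≠ 0 := by omega
      have h4 : 0 < -n := by omega
      rw [realComponent, if_neg h3, if_pos h4, inv_mul_cancel_left₀ h2, hconj, Complex.conj_re]
    · have h3 : n ≠ 0 := by omega
      have h4 : ¬ 0 < n := by omega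
      rw [realComponent, if_neg h3, if_neg h4, neg_mul, inv_mul_cancel_left₀ h2, hconj,
        Complex.conj_im]
  · refine ⟨⟨1, 0, by norm_num, fun t ω => by simp [realComponent]⟩,
      ⟨0, 0, by norm_num, fun t ω => ?_⟩⟩
    have := congrArg Complex.im (hW.conj_symm 0 t ω)
    rw [neg_zero, Complex.conj_im] at this
    rw [zero_mul]
    linarith
  · refine ⟨⟨(√2)⁻¹, n, hc, fun t ω => ?_⟩, ⟨(√2)⁻¹, -n, hc, fun t ω => ?_⟩⟩
    · rw [realComponent, if_neg hn.ne', if_pos hn, inv_mul_cancel_left₀ h2]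
    · have h3 : -n ≠ 0 := by omega
      have h4 : ¬ 0 < -n := by omega
      rw [realComponent, if_neg h3, if_neg h4, neg_neg, inv_mul_cancel_left₀ h2]

theorem IsCylindricalWiener.ae_continuous (hW : IsCylindricalWiener W P) :
    ∀ᵐ ω ∂P, ∀ n, Continuous fun t => W n t ω := by
  have h : ∀ᵐ ω ∂P, ∀ k, Continuous fun t => realComponent W k t ω :=
    ae_all_iff.2 fun k => (hW.isBrownian k).cont
  filter_upwards [h] with ω hω n
  obtain ⟨⟨c, k, _, hre⟩, ⟨c', k', _, him⟩⟩ := hW.exists_re_im n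
  have he : ∀ t, W n t ω = ((c * realComponent W k t ω : ℝ) : ℂ)
      + ((c' * realComponent W k' t ω : ℝ) : ℂ) * Complex.I := fun t => by
    rw [← hre, ← him, Complex.re_add_im]
  simp only [he]
  have h1 := hω k
  have h2 := hω k'
  fun_prop

/-- Real and imaginary parts are each bounded by the scalar inequality and added, whence `16 = 8 +
8`; their mutual independence plays no role. -/
theorem IsCylindricalWiener.exists_maximal_riemannSum (hW : IsCylindricalWiener W P) (n : ℤ)
    (h : ℝ≥0) (N : ℕ) {g : ℕ → ℝ} {G : ℝ} (hg : ∀ i < N, |g i| ≤ G) :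
    ∃ Y : Ω → ℝ, Integrable Y P ∧ (∀ ω, 0 ≤ Y ω) ∧
      (∀ ω, ∀ k ≤ N, ‖∑ i ∈ Finset.range k,
        (g i : ℂ) * (W n ((i + 1 : ℕ) * h) ω - W n (i * h) ω)‖ ^ 2 ≤ Y ω) ∧
      ∫ ω, Y ω ∂P ≤ 16 * (G ^ 2 * (N * h)) := by
  obtain ⟨⟨c, k, hc, hre⟩, ⟨c', k', hc', him⟩⟩ := hW.exists_re_im n
  obtain ⟨Y, hY, hY0, hYb, hYi⟩ :=
    exists_maximal_brownian (hW.isBrownian k).toIsPreBrownianReal h N hg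
  obtain ⟨Y', hY', hY0', hYb', hYi'⟩ :=
    exists_maximal_brownian (hW.isBrownian k').toIsPreBrownianReal h N hg
  refine ⟨fun ω => Y ω + Y' ω, hY.add hY', fun ω => add_nonneg (hY0 ω) (hY0' ω),
    fun ω m hm => ?_, ?_⟩
  · rw [Complex.sq_norm, Complex.normSq_apply, ← sq, ← sq, Complex.re_sum, Complex.im_sum]
    have e1 : ∑ i ∈ Finset.range m, ((g i : ℂ) * (W n ((i + 1 : ℕ) * h) ω - W n (i * h) ω)).re
        = c * ∑ i ∈ Finset.range m, g i * (realComponent W k ((i + 1 : ℕ) * h) ω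
          - realComponent W k (i * h) ω) := by
      rw [Finset.mul_sum]
      refine Finset.sum_congr rfl fun i _ => ?_
      rw [Complex.re_ofReal_mul, Complex.sub_re, hre, hre]
      ring
    have e2 : ∑ i ∈ Finset.range m, ((g i : ℂ) * (W n ((i + 1 : ℕ) * h) ω - W n (i * h) ω)).im
        = c' * ∑ i ∈ Finset.range m, g i * (realComponent W k' ((i + 1 : ℕ) * h) ω
          - realComponent W k' (i * h) ω) := by
      rw [Finset.mul_sum]
      refine Finset.sum_congr rfl fun i _ => ?_
      rw [Complex.im_ofReal_mul, Complex.sub_im, him, him]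
      ring
    rw [e1, e2, mul_pow, mul_pow]
    have h1 := hYb ω m hm
    have h2 := hYb' ω m hm
    exact add_le_add ((mul_le_of_le_one_left (sq_nonneg _) hc).trans h1)
      ((mul_le_of_le_one_left (sq_nonneg _) hc').trans h2)
  · rw [integral_add hY hY']
    linarith

/-- Doob's maximal inequality for Wiener integrals. -/
theorem IsCylindricalWiener.exists_maximal_wienerIntegral (hW : IsCylindricalWiener W P) (n : ℤ)
    {g : ℝ → ℝ} (hg : ContDiff ℝ 1 g) {T : ℝ≥0} (hT : 0 < T) {G : ℝ}
    (hG : ∀ r : ℝ, 0 ≤ r → r ≤ T → |g r| ≤ G) :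
    ∃ Y : Ω → ENNReal, AEMeasurable Y P ∧ ∫⁻ ω, Y ω ∂P ≤ ENNReal.ofReal (16 * (G ^ 2 * T)) ∧
      ∀ᵐ ω ∂P, ∀ t ≤ T, ENNReal.ofReal (‖wienerIntegral g (fun r => W n r ω) t‖ ^ 2) ≤ Y ω := by
  have hNT : ∀ N : ℕ, ((N + 1 : ℕ) : ℝ≥0) * (T / (N + 1 : ℕ)) = T := fun N =>
    mul_div_cancel₀ _ (by positivity)
  choose Y hY hY0 hYb hYi using fun N : ℕ => hW.exists_maximal_riemannSum n (T / (N + 1 : ℕ)) (N + 1)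
    (g := fun i => g (i * (T / (N + 1 : ℕ) : ℝ≥0))) (G := G) (fun i hi => by
      refine hG _ (by positivity) ?_
      have : (i : ℝ≥0) * (T / (N + 1 : ℕ)) ≤ T := by
        nth_rewrite 2 [← hNT N]
        gcongr
      exact_mod_cast this)
  have hm : ∀ N, AEMeasurable (fun ω => ENNReal.ofReal (Y N ω)) P := fun N =>
    (hY N).1.aemeasurable.ennreal_ofReal
  -- Fatou's lemma bounds the expectation of the liminf. Since each `Y N` dominates the Riemann sums
  -- up to every grid point, the liminf dominates the Wiener integral for all `t ≤ T`
  -- simultaneously.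
  refine ⟨fun ω => liminf (fun N => ENNReal.ofReal (Y N ω)) atTop,
    ⟨fun ω => liminf (fun N => (hm N).mk _ ω) atTop, .liminf fun N => (hm N).measurable_mk, ?_⟩,
    ?_, ?_⟩
  · filter_upwards [ae_all_iff.2 fun N => (hm N).ae_eq_mk] with ω hω
    simp only [hω]
  · refine (lintegral_liminf_le' hm).trans ?_
    refine liminf_le_of_frequently_le' (Eventually.of_forall fun N => ?_).frequently
    rw [← ofReal_integral_eq_lintegral_ofReal (hY N) (Eventually.of_forall (hY0 N))]
    refine ENNReal.ofReal_le_ofReal ((hYi N).trans (le_of_eq ?_))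
    have := congrArg ((↑) : ℝ≥0 → ℝ) (hNT N)
    rw [NNReal.coe_mul, NNReal.coe_natCast] at this
    rw [this]
  · filter_upwards [hW.ae_continuous] with ω hω t ht
    have hlim := ENNReal.tendsto_ofReal ((tendsto_riemannSum hg (hω n) ht hT).norm.pow 2)
    rw [← hlim.liminf_eq]
    refine liminf_le_liminf (Eventually.of_forall fun N => ENNReal.ofReal_le_ofReal ?_)
    refine hYb N ω _ ?_
    have hpos : (0 : ℝ≥0) < T / (N + 1 : ℕ) := div_pos hT (by positivity)
    refine Nat.floor_le_of_le ?_
    rw [div_le_iff₀ hpos, hNT]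
    exact ht

end

/-! ### The stochastic convolution -/

/-- The integrand `e^{r/2} cos(λₙ r)`. -/
noncomputable def waveCos (n : ℤ) (r : ℝ) : ℝ := Real.exp (r / 2) * Real.cos (r * freq n)

/-- The integrand `e^{r/2} sin(λₙ r)`. -/
noncomputable def waveSin (n : ℤ) (r : ℝ) : ℝ := Real.exp (r / 2) * Real.sin (r * freq n)

theorem contDiff_waveCos (n : ℤ) : ContDiff ℝ 1 (waveCos n) := by
  unfold waveCos
  fun_prop

theorem contDiff_waveSin (n : ℤ) : ContDiff ℝ 1 (waveSin n) := by
  unfold waveSin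
  fun_prop

theorem abs_waveCos_le (n : ℤ) {r T : ℝ} (h : r ≤ T) : |waveCos n r| ≤ Real.exp (T / 2) := by
  rw [waveCos, abs_mul, abs_of_pos (Real.exp_pos _)]
  exact (mul_le_of_le_one_right (Real.exp_pos _).le (Real.abs_cos_le_one _)).trans
    (Real.exp_le_exp.2 (by linarith))

theorem abs_waveSin_le (n : ℤ) {r T : ℝ} (h : r ≤ T) : |waveSin n r| ≤ Real.exp (T / 2) := by
  rw [waveSin, abs_mul, abs_of_pos (Real.exp_pos _)]
  exact (mul_le_of_le_one_right (Real.exp_pos _).le (Real.abs_sin_le_one _)).trans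
    (Real.exp_le_exp.2 (by linarith))

/-- The addition formula separates `t` from `r`. The stochastic convolution becomes a combination,
with bounded coefficients depending on `t`, of Wiener integrals whose integrands do not depend on
`t`; a maximal inequality applies to those. -/
theorem propagator_sub_eq (n : ℤ) (t r : ℝ) : propagator n (t - r) =
    Real.exp (-t / 2) * (Real.sin (t * freq n) / freq n) * waveCos n r +
      -(Real.exp (-t / 2) * (Real.cos (t * freq n) / freq n)) * waveSin n r := by
  have he : Real.exp (-(t - r) / 2) = Real.exp (-t / 2) * Real.exp (r / 2) := by
    rw [← Real.exp_add]
    ring_nf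
  rw [propagator_eq, he, sub_mul, Real.sin_sub, waveCos, waveSin]
  ring

theorem propagator'_sub_eq (n : ℤ) (t r : ℝ) : propagator' n (t - r) =
    Real.exp (-t / 2) * (Real.cos (t * freq n) - Real.sin (t * freq n) / (2 * freq n))
        * waveCos n r +
      Real.exp (-t / 2) * (Real.sin (t * freq n) + Real.cos (t * freq n) / (2 * freq n))
        * waveSin n r := by
  have he : Real.exp (-(t - r) / 2) = Real.exp (-t / 2) * Real.exp (r / 2) := by
    rw [← Real.exp_add]
    ring_nf
  rw [propagator'_eq, he, sub_mul, Real.sin_sub, Real.cos_sub, waveCos, waveSin]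
  ring

theorem wienerIntegral_add_mul {g h : ℝ → ℝ} (hg : ContDiff ℝ 1 g) (hh : ContDiff ℝ 1 h)
    {w : ℝ≥0 → ℂ} (hw : Continuous w) (a b : ℝ) (t : ℝ≥0) :
    wienerIntegral (fun r => a * g r + b * h r) w t
      = a * wienerIntegral g w t + b * wienerIntegral h w t := by
  have hd : ∀ r, deriv (fun r => a * g r + b * h r) r = a * deriv g r + b * deriv h r := fun r =>
    (((hg.differentiable one_ne_zero).differentiableAt.hasDerivAt.const_mul a).add
      ((hh.differentiable one_ne_zero).differentiableAt.hasDerivAt.const_mul b)).deriv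
  have hi : ∫ r in (0 : ℝ)..t, ((a * deriv g r + b * deriv h r : ℝ) : ℂ) * w r.toNNReal
      = a * (∫ r in (0 : ℝ)..t, ((deriv g r : ℝ) : ℂ) * w r.toNNReal)
        + b * ∫ r in (0 : ℝ)..t, ((deriv h r : ℝ) : ℂ) * w r.toNNReal := by
    rw [← intervalIntegral.integral_const_mul, ← intervalIntegral.integral_const_mul,
      ← intervalIntegral.integral_add
        (((continuous_wienerIntegrand hg hw).const_mul _).intervalIntegrable _ _)
        (((continuous_wienerIntegrand hh hw).const_mul _).intervalIntegrable _ _)]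
    refine intervalIntegral.integral_congr fun r _ => ?_
    push_cast
    ring
  simp only [wienerIntegral, hd, hi]
  push_cast
  ring

theorem wienerIntegral_conj {g : ℝ → ℝ} {w w' : ℝ≥0 → ℂ} (h : ∀ t, w' t = conj (w t)) (t : ℝ≥0) :
    wienerIntegral g w' t = conj (wienerIntegral g w t) := by
  simp only [wienerIntegral, intervalIntegral, h, map_sub, map_mul, Complex.conj_ofReal,
    ← integral_conj]

theorem stochConv_eq {w : ℤ → ℝ≥0 → ℂ} {n : ℤ} (hw : Continuous (w n)) (t : ℝ≥0) :
    stochConv w n t = √2 * (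
      (Real.exp (-t / 2) * (Real.sin (t * freq n) / freq n) : ℝ)
        * wienerIntegral (waveCos n) (w n) t +
      (-(Real.exp (-t / 2) * (Real.cos (t * freq n) / freq n)) : ℝ)
        * wienerIntegral (waveSin n) (w n) t) := by
  simp only [stochConv, propagator_sub_eq]
  rw [wienerIntegral_add_mul (contDiff_waveCos n) (contDiff_waveSin n) hw]

theorem stochConvVelocity_eq {w : ℤ → ℝ≥0 → ℂ} {n : ℤ} (hw : Continuous (w n)) (t : ℝ≥0) :
    stochConvVelocity w n t = √2 * (
      (Real.exp (-t / 2) * (Real.cos (t * freq n) - Real.sin (t * freq n) / (2 * freq n)) : ℝ)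
        * wienerIntegral (waveCos n) (w n) t +
      (Real.exp (-t / 2) * (Real.sin (t * freq n) + Real.cos (t * freq n) / (2 * freq n)) : ℝ)
        * wienerIntegral (waveSin n) (w n) t) := by
  simp only [stochConvVelocity, propagator'_sub_eq]
  rw [wienerIntegral_add_mul (contDiff_waveCos n) (contDiff_waveSin n) hw]

theorem energy_le_of_coeff_le (n : ℤ) {x y z v : ℝ} (f g : ℂ)
    (hx : (1 + (n : ℝ) ^ 2) * x ^ 2 ≤ 4) (hy : (1 + (n : ℝ) ^ 2) * y ^ 2 ≤ 4)
    (hz : z ^ 2 ≤ 4) (hv : v ^ 2 ≤ 4) :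
    energy n (√2 * (x * f + y * g)) (√2 * (z * f + v * g)) ≤ 32 * (‖f‖ ^ 2 + ‖g‖ ^ 2) := by
  have e1 := norm_add_sq_le_two (x * f) (y * g)
  have e2 := norm_add_sq_le_two (z * f) (v * g)
  rw [energy_mul, Complex.norm_real, Real.norm_eq_abs, sq_abs, Real.sq_sqrt (by norm_num)]
  simp only [norm_mul, Complex.norm_real, mul_pow, Real.norm_eq_abs, sq_abs] at e1 e2
  have a1 := mul_le_mul_of_nonneg_right hx (sq_nonneg ‖f‖)
  have a2 := mul_le_mul_of_nonneg_right hy (sq_nonneg ‖g‖)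
  have a3 := mul_le_mul_of_nonneg_right hz (sq_nonneg ‖f‖)
  have a4 := mul_le_mul_of_nonneg_right hv (sq_nonneg ‖g‖)
  have a5 := mul_le_mul_of_nonneg_left e1 (weight_pos n).le
  unfold energy
  linarith

theorem energy_stochConv_le {w : ℤ → ℝ≥0 → ℂ} {n : ℤ} (hw : Continuous (w n)) (t : ℝ≥0) :
    energy n (stochConv w n t) (stochConvVelocity w n t) ≤
      32 * (‖wienerIntegral (waveCos n) (w n) t‖ ^ 2
        + ‖wienerIntegral (waveSin n) (w n) t‖ ^ 2) := by
  rw [stochConv_eq hw, stochConvVelocity_eq hw]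
  have hE : Real.exp (-t / 2) ≤ 1 :=
    Real.exp_le_one_iff.2 (by have := t.2; simp only [NNReal.val_eq_coe] at this; linarith)
  have hE2 : Real.exp (-t / 2) ^ 2 ≤ 1 := pow_le_one₀ (Real.exp_pos _).le hE
  have hE0 : 0 ≤ Real.exp (-(t : ℝ) / 2) ^ 2 := sq_nonneg _
  have hsc := Real.sin_sq_add_cos_sq (t * freq n)
  have hs := sq_nonneg (Real.sin (t * freq n))
  have hc := sq_nonneg (Real.cos (t * freq n))
  have hl := freq_sq n
  have hlpos := freq_pos n
  have hl2 : 0 < freq n ^ 2 := by positivity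
  have hn := sq_nonneg (n : ℝ)
  -- Since `freq n ^ 2 = 3/4 + n²`, dividing by the frequency gains a full power of `⟨n⟩`, uniformly
  -- in `n`.
  have hinv : (1 + (n : ℝ) ^ 2) / freq n ^ 2 ≤ 4 := by
    rw [div_le_iff₀ hl2]
    linarith
  have hinv0 : 0 ≤ (1 + (n : ℝ) ^ 2) / freq n ^ 2 := by positivity
  have hdiv : ∀ x : ℝ, x ^ 2 ≤ 1 → (x / (2 * freq n)) ^ 2 ≤ 1 := fun x hx => by
    rw [div_pow, div_le_one (by positivity)]
    nlinarith
  have h4 : ∀ x y : ℝ, x ^ 2 ≤ 1 → y ^ 2 ≤ 1 →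
      (Real.exp (-t / 2) * (x + y / (2 * freq n))) ^ 2 ≤ 4 := fun x y hx hy => by
    rw [mul_pow]
    refine (mul_le_of_le_one_left (sq_nonneg _) hE2).trans ?_
    nlinarith [hdiv y hy, sq_nonneg (x - y / (2 * freq n))]
  have h5 : ∀ x : ℝ, x ^ 2 ≤ 1 →
      (1 + (n : ℝ) ^ 2) * (Real.exp (-t / 2) * (x / freq n)) ^ 2 ≤ 4 := fun x hx => by
    have he : (1 + (n : ℝ) ^ 2) * (Real.exp (-t / 2) * (x / freq n)) ^ 2
        = ((1 + (n : ℝ) ^ 2) / freq n ^ 2) * (Real.exp (-t / 2) ^ 2 * x ^ 2) := by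
      ring
    rw [he]
    exact (mul_le_of_le_one_right hinv0 (mul_le_one₀ hE2 (sq_nonneg x) hx)).trans hinv
  refine energy_le_of_coeff_le n _ _ (h5 _ (by linarith)) ?_ ?_ (h4 _ _ (by linarith) (by linarith))
  · rw [neg_sq]
    exact h5 _ (by linarith)
  · have := h4 (Real.cos (t * freq n)) (-Real.sin (t * freq n)) (by linarith)
      (by rw [neg_sq]; linarith)
    rwa [neg_div (2 * freq n), ← sub_eq_add_neg] at this

/-- The properties of a realization of the noise that are used in the solution theory: the
oscillating Wiener integrals satisfy a locally uniform bound, summable in `H^{σ-1}`, `σ < 1/2`. -/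
structure IsRegularNoise (w : ℤ → ℝ≥0 → ℂ) : Prop where
  conj_symm : ∀ n t, w (-n) t = conj (w n t)
  continuous : ∀ n, Continuous (w n)
  maximal : ∀ T : ℝ≥0, ∃ b : ℤ → ℝ,
    (∀ σ < (1 / 2 : ℝ), Summable fun n : ℤ => (1 + (n : ℝ) ^ 2) ^ (σ - 1) * b n) ∧
    ∀ t ≤ T, ∀ n, ‖wienerIntegral (waveCos n) (w n) t‖ ^ 2
      + ‖wienerIntegral (waveSin n) (w n) t‖ ^ 2 ≤ b n

theorem IsRegularNoise.isPhasePath {w : ℤ → ℝ≥0 → ℂ} (hw : IsRegularNoise w) {σ : ℝ}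
    (hσ : σ < 1 / 2) :
    IsPhasePath σ (fun t n => stochConv w n t) (fun t n => stochConvVelocity w n t) where
  continuous_fst n := by
    have h1 := continuous_wienerIntegral (contDiff_waveCos n) (hw.continuous n)
    have h2 := continuous_wienerIntegral (contDiff_waveSin n) (hw.continuous n)
    simp only [stochConv_eq (hw.continuous n)]
    fun_prop
  continuous_snd n := by
    have h1 := continuous_wienerIntegral (contDiff_waveCos n) (hw.continuous n)
    have h2 := continuous_wienerIntegral (contDiff_waveSin n) (hw.continuous n)
    simp only [stochConvVelocity_eq (hw.continuous n)]
    fun_prop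
  dominated T := by
    obtain ⟨b, hb, hbd⟩ := hw.maximal T
    refine ⟨_, (hb σ hσ).mul_left 32, fun t ht n => ?_⟩
    rw [mul_left_comm]
    refine mul_le_mul_of_nonneg_left ?_ (Real.rpow_nonneg (weight_pos n).le _)
    exact (energy_stochConv_le (hw.continuous n) t).trans
      (mul_le_mul_of_nonneg_left (hbd t ht n) (by norm_num))

theorem stochConv_conj {w : ℤ → ℝ≥0 → ℂ} (hw : ∀ n t, w (-n) t = conj (w n t)) (n : ℤ)
    (t : ℝ≥0) : stochConv w (-n) t = conj (stochConv w n t) := by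
  simp only [stochConv, propagator_neg, map_mul, Complex.conj_ofReal]
  rw [wienerIntegral_conj (hw n)]

theorem stochConvVelocity_conj {w : ℤ → ℝ≥0 → ℂ} (hw : ∀ n t, w (-n) t = conj (w n t)) (n : ℤ)
    (t : ℝ≥0) : stochConvVelocity w (-n) t = conj (stochConvVelocity w n t) := by
  simp only [stochConvVelocity, propagator'_neg, map_mul, Complex.conj_ofReal]
  rw [wienerIntegral_conj (hw n)]

/-! ### Almost sure regularity of the noise -/

section

variable {Ω : Type*} [MeasurableSpace Ω] {P : Measure Ω} {W : ℤ → ℝ≥0 → Ω → ℂ}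

/-- A sequence of nonnegative random variables with bounded expectations is almost surely in all
weighted `ℓ¹` spaces with weight `(1 + n²)^{σ-1}`, `σ < 1/2`. -/
theorem ae_summable_weight {Y : ℤ → Ω → ENNReal} (hm : ∀ n, AEMeasurable (Y n) P) {C : ℝ}
    (hY : ∀ n, ∫⁻ ω, Y n ω ∂P ≤ ENNReal.ofReal C) :
    ∀ᵐ ω ∂P, (∀ n, Y n ω ≠ ⊤) ∧ ∀ σ < (1 / 2 : ℝ),
      Summable fun n : ℤ => (1 + (n : ℝ) ^ 2) ^ (σ - 1) * (Y n ω).toReal := by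
  have hfin : ∀ n, ∀ᵐ ω ∂P, Y n ω ≠ ⊤ := fun n => by
    filter_upwards [ae_lt_top' (hm n) ((hY n).trans_lt ENNReal.ofReal_lt_top).ne] with ω h
    exact h.ne
  -- The countably many exponents `1/2 - 1/(k+1)` increase to `1/2`, so a single null set serves all
  -- `σ < 1/2`. For each of them the weight exponent is below `-1/2`, hence summable.
  have hsum : ∀ k : ℕ, ∀ᵐ ω ∂P,
      ∑' n : ℤ, ENNReal.ofReal ((1 + (n : ℝ) ^ 2) ^ ((1 / 2 - 1 / ((k : ℝ) + 1)) - 1)) * Y n ω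
        ≠ ⊤ := by
    intro k
    have hw : Summable fun n : ℤ => (1 + (n : ℝ) ^ 2) ^ ((1 / 2 - 1 / ((k : ℝ) + 1)) - 1) := by
      refine summable_weight ?_
      have : 0 < 1 / ((k : ℝ) + 1) := by positivity
      linarith
    have hmk : ∀ n : ℤ, AEMeasurable (fun ω =>
        ENNReal.ofReal ((1 + (n : ℝ) ^ 2) ^ ((1 / 2 - 1 / ((k : ℝ) + 1)) - 1)) * Y n ω) P :=
      fun n => (hm n).const_mul _
    have hlt : ∫⁻ ω, ∑' n : ℤ,
        ENNReal.ofReal ((1 + (n : ℝ) ^ 2) ^ ((1 / 2 - 1 / ((k : ℝ) + 1)) - 1)) * Y n ω ∂P < ⊤ := by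
      rw [lintegral_tsum hmk]
      calc _ ≤ ∑' n : ℤ, ENNReal.ofReal ((1 + (n : ℝ) ^ 2) ^ ((1 / 2 - 1 / ((k : ℝ) + 1)) - 1))
              * ENNReal.ofReal C := by
            refine ENNReal.tsum_le_tsum fun n => ?_
            rw [lintegral_const_mul'' _ (hm n)]
            gcongr
            exact hY n
        _ = ENNReal.ofReal (∑' n : ℤ, (1 + (n : ℝ) ^ 2) ^ ((1 / 2 - 1 / ((k : ℝ) + 1)) - 1))
              * ENNReal.ofReal C := by
            rw [ENNReal.tsum_mul_right, ENNReal.ofReal_tsum_of_nonneg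
              (fun n => Real.rpow_nonneg (weight_pos n).le _) hw]
        _ < ⊤ := ENNReal.mul_lt_top ENNReal.ofReal_lt_top ENNReal.ofReal_lt_top
    filter_upwards [ae_lt_top' (AEMeasurable.tsum hmk) hlt.ne] with ω h
    exact h.ne
  filter_upwards [ae_all_iff.2 hfin, ae_all_iff.2 hsum] with ω h1 h2
  refine ⟨h1, fun σ hσ => ?_⟩
  obtain ⟨k, hk⟩ := exists_nat_one_div_lt (sub_pos.2 hσ)
  have h3 := ENNReal.summable_toReal (h2 k)
  refine h3.of_nonneg_of_le (fun n => by positivity) fun n => ?_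
  rw [ENNReal.toReal_mul, ENNReal.toReal_ofReal (Real.rpow_nonneg (weight_pos n).le _)]
  refine mul_le_mul_of_nonneg_right ?_ ENNReal.toReal_nonneg
  exact Real.rpow_le_rpow_of_exponent_le (one_le_weight n) (by linarith)

/-- The integrands `waveCos n` and `waveSin n` are bounded on `[0, T]` by `e^{T/2}` uniformly in
`n`, so Doob's bound is the same for all modes. Only integer horizons are needed, and the
exceptional null set does not depend on any initial datum. -/
theorem IsCylindricalWiener.ae_isRegularNoise (hW : IsCylindricalWiener W P) :
    ∀ᵐ ω ∂P, IsRegularNoise fun n r => W n r ω := by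
  have hmax : ∀ T : ℕ, ∀ᵐ ω ∂P, ∃ b : ℤ → ℝ,
      (∀ σ < (1 / 2 : ℝ), Summable fun n : ℤ => (1 + (n : ℝ) ^ 2) ^ (σ - 1) * b n) ∧
      ∀ t ≤ ((T + 1 : ℕ) : ℝ≥0), ∀ n, ‖wienerIntegral (waveCos n) (fun r => W n r ω) t‖ ^ 2
        + ‖wienerIntegral (waveSin n) (fun r => W n r ω) t‖ ^ 2 ≤ b n := by
    intro T
    have hT : (0 : ℝ≥0) < (T + 1 : ℕ) := by positivity
    choose Y hYm hYi hYb using fun n : ℤ => hW.exists_maximal_wienerIntegral n (contDiff_waveCos n)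
      hT (fun r _ hr => abs_waveCos_le n hr)
    choose Z hZm hZi hZb using fun n : ℤ => hW.exists_maximal_wienerIntegral n (contDiff_waveSin n)
      hT (fun r _ hr => abs_waveSin_le n hr)
    filter_upwards [ae_summable_weight hYm hYi, ae_summable_weight hZm hZi, ae_all_iff.2 hYb,
      ae_all_iff.2 hZb] with ω hY hZ hYω hZω
    refine ⟨fun n => (Y n ω).toReal + (Z n ω).toReal, fun σ hσ => ?_, fun t ht n => ?_⟩
    · simpa only [mul_add] using (hY.2 σ hσ).add (hZ.2 σ hσ)
    · exact add_le_add ((ENNReal.ofReal_le_iff_le_toReal (hY.1 n)).1 (hYω n t ht))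
        ((ENNReal.ofReal_le_iff_le_toReal (hZ.1 n)).1 (hZω n t ht))
  filter_upwards [hW.ae_continuous, ae_all_iff.2 hmax] with ω hc hm
  refine ⟨fun n t => hW.conj_symm n t ω, hc, fun T => ?_⟩
  obtain ⟨b, hb, hbd⟩ := hm ⌈T⌉₊
  refine ⟨b, hb, fun t ht => hbd t (ht.trans ((Nat.le_ceil T).trans ?_))⟩
  exact_mod_cast Nat.le_succ _

end

/-! ### Properties of the flow -/

section

variable {s : ℝ} {w : ℤ → ℝ≥0 → ℂ}

theorem isMildSolution_iff {γ β : ℝ} {u₀ : Phase s} {Φ : C(ℝ≥0, Phase s)} :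
    IsMildSolution γ β w u₀ Φ ↔ ∀ t n,
      (Φ t).1.coeff n = (linearPosition n t (u₀.1.coeff n) (u₀.2.coeff n) + stochConv w n t)
        - γ * ∫ r in (0 : ℝ)..t,
          (propagator n (t - r) : ℂ) * sinCoeff β (Φ r.toNNReal).1.coeff n ∧
      (Φ t).2.coeff n = (linearVelocity n t (u₀.1.coeff n) (u₀.2.coeff n)
        + stochConvVelocity w n t) - γ * ∫ r in (0 : ℝ)..t,
          (propagator' n (t - r) : ℂ) * sinCoeff β (Φ r.toNNReal).1.coeff n :=
  ⟨fun h t n => ⟨h.position t n, h.velocity t n⟩, fun h => ⟨fun t n => (h t n).1,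
    fun t n => (h t n).2⟩⟩

theorem IsRegularNoise.existsUnique (hw : IsRegularNoise w) (hs : 0 ≤ s) (hs' : s < 1 / 2)
    (γ β : ℝ) (u₀ : Phase s) : ∃! Φ : C(ℝ≥0, Phase s), IsMildSolution γ β w u₀ Φ := by
  simp only [isMildSolution_iff]
  refine existsUnique_mild hs (by linarith) γ β
    ((isPhasePath_linear (inPhase_self u₀)).add (hw.isPhasePath hs')) (fun t n => ?_) fun t n => ?_
  · simp only [stochConv_conj hw.conj_symm, linearPosition, propagator_neg, propagator'_neg,
      Sobolev.coeff_neg_eq, map_add, map_mul, Complex.conj_ofReal]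
  · simp only [stochConvVelocity_conj hw.conj_symm, linearVelocity, propagator'_neg,
      propagator'', Sobolev.coeff_neg_eq, map_add, map_mul, Complex.conj_ofReal]

/-- Solutions have the Sobolev regularity of their initial data, below the threshold `1/2`. -/
theorem IsRegularNoise.inPhase_iff (hw : IsRegularNoise w) (hs : 0 ≤ s) {γ β : ℝ} {u₀ : Phase s}
    {Φ : C(ℝ≥0, Phase s)} (hΦ : IsMildSolution γ β w u₀ Φ) {σ : ℝ} (hσ : σ < 1 / 2) (t : ℝ≥0) :
    InPhase σ (Φ t) ↔ InPhase σ u₀ := by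
  obtain ⟨u, hu⟩ := exists_position hs Φ
  -- Everything in the solution except `S(t)u₀` is in `𝓗^σ`, whatever the regularity of `u₀`.
  have hR := (hw.isPhasePath hσ).add
    ((isPhasePath_duhamel_sin (σ := σ) (by linarith) β u).const_mul (-γ))
  have hRt := memH_pair_iff.2 (hR.summable t)
  simp only [hu] at hRt
  have h1 := fun n => hΦ.position t n
  have h2 := fun n => hΦ.velocity t n
  rw [InPhase, InPhase, ← memH_linear_iff (f := u₀.1.coeff) t]
  constructor
  · intro h
    constructor
    · convert (h.1.add (hRt.1.const_mul (-1))) using 1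
      funext n
      rw [h1]
      ring
    · convert (h.2.add (hRt.2.const_mul (-1))) using 1
      funext n
      rw [h2]
      ring
  · intro h
    constructor
    · convert h.1.add hRt.1 using 1
      funext n
      rw [h1]
      ring
    · convert h.2.add hRt.2 using 1
      funext n
      rw [h2]
      ring

/-- Existence ensures that `flow` takes the value of a genuine mild solution and not its default
`0`. -/
theorem IsRegularNoise.inPhase_flow_iff (hw : IsRegularNoise w) (hs : 0 ≤ s) (hs' : s < 1 / 2)
    (γ β : ℝ) (u₀ : Phase s) {σ : ℝ} (hσ : σ < 1 / 2) (t : ℝ≥0) :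
    InPhase σ (flow γ β s w u₀ t) ↔ InPhase σ u₀ := by
  have h := (hw.existsUnique hs hs' γ β u₀).exists
  rw [flow, dif_pos h]
  exact hw.inPhase_iff hs h.choose_spec hσ t

end

/-! ### The indicator functions -/

/-- The squared `H^σ` norm, with values in `[0, ∞]`, is a countable sum of continuous functions, and
membership is its finiteness. -/
theorem measurableSet_memH {s : ℝ} (σ : ℝ) : MeasurableSet {u : Sobolev s | MemH σ u.coeff} := by
  have hm : Measurable fun u : Sobolev s =>
      ∑' n : ℤ, ENNReal.ofReal ((1 + (n : ℝ) ^ 2) ^ σ * ‖u.coeff n‖ ^ 2) := by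
    refine Measurable.tsum fun n => Measurable.ennreal_ofReal ?_
    exact (((Sobolev.continuous_coeff n).norm.pow 2).const_mul _).measurable
  have he : {u : Sobolev s | MemH σ u.coeff} = {u : Sobolev s |
      ∑' n : ℤ, ENNReal.ofReal ((1 + (n : ℝ) ^ 2) ^ σ * ‖u.coeff n‖ ^ 2) ≠ ⊤} := by
    ext u
    constructor
    · intro h
      exact h.tsum_ofReal_ne_top
    · intro h
      refine (ENNReal.summable_toReal h).congr fun n => ?_
      rw [ENNReal.toReal_ofReal (by positivity)]
  rw [he]
  exact (hm (measurableSet_singleton ⊤)).compl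

theorem measurableSet_inPhase (s σ : ℝ) : MeasurableSet {u : Phase s | InPhase σ u} :=
  (measurable_fst (measurableSet_memH σ)).inter (measurable_snd (measurableSet_memH (σ - 1)))

theorem measurable_indicatorPhase (s σ : ℝ) : Measurable (indicatorPhase s σ) :=
  Measurable.ite (measurableSet_inPhase s σ) measurable_const measurable_const

theorem forall_inPhase_iff {s : ℝ} (u : Phase s) : (∀ σ < (1 / 2 : ℝ), InPhase σ u) ↔
    ∀ k : ℕ, InPhase (1 / 2 - 1 / ((k : ℝ) + 1)) u := by
  constructor
  · intro h k
    have : 0 < 1 / ((k : ℝ) + 1) := by positivity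
    exact h _ (by linarith)
  · intro h σ hσ
    obtain ⟨k, hk⟩ := exists_nat_one_div_lt (sub_pos.2 hσ)
    exact (h k).mono (by linarith)

theorem measurable_indicatorPhaseHalfMinus (s : ℝ) : Measurable (indicatorPhaseHalfMinus s) := by
  refine Measurable.ite ?_ measurable_const measurable_const
  simp only [forall_inPhase_iff, Set.ofPred_forall]
  exact MeasurableSet.iInter fun k => measurableSet_inPhase s _

/-! ### Discontinuity and conservation of the indicators -/

theorem inPhase_smul_iff {s σ : ℝ} {c : ℝ} (hc : c ≠ 0) (u : Phase s) :
    InPhase σ (c • u) ↔ InPhase σ u := by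
  have key : ∀ (c : ℝ) (u : Phase s), InPhase σ u → InPhase σ (c • u) := fun c u h =>
    ⟨h.1.const_mul c, h.2.const_mul c⟩
  refine ⟨fun h => ?_, key c u⟩
  have := key c⁻¹ _ h
  rwa [smul_smul, inv_mul_cancel₀ hc, one_smul] at this

theorem inPhase_zero (s σ : ℝ) : InPhase σ (0 : Phase s) := by
  have h : ∀ τ, MemH τ (0 : ℤ → ℂ) := fun τ => (sobolevSubmodule τ).zero_mem.1
  exact ⟨h σ, h (σ - 1)⟩

/-- `H^σ` is a proper subset of `H^s` for `s < σ`. -/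
theorem exists_not_inPhase {s σ : ℝ} (h : s < σ) : ∃ u : Phase s, ¬ InPhase σ u := by
  -- The coefficients are critical for the midpoint regularity `(s + σ) / 2`: the `H^s` sum has
  -- exponent `-1/2 - (σ - s)/2` and converges, while the `H^σ` sum has exponent `-1/2 + (σ - s)/2`
  -- and dominates the harmonic series.
  have hsq : ∀ n : ℤ, ‖(((1 + (n : ℝ) ^ 2) ^ (-(1 / 4 : ℝ) - (s + σ) / 4) : ℝ) : ℂ)‖ ^ 2
      = (1 + (n : ℝ) ^ 2) ^ (-(1 / 2 : ℝ) - (s + σ) / 2) := fun n => by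
    rw [Complex.norm_real, Real.norm_of_nonneg (Real.rpow_nonneg (weight_pos n).le _),
      ← Real.rpow_natCast, ← Real.rpow_mul (weight_pos n).le]
    congr 1
    push_cast
    ring
  have hτ : ∀ τ (n : ℤ), (1 + (n : ℝ) ^ 2) ^ τ *
      ‖(((1 + (n : ℝ) ^ 2) ^ (-(1 / 4 : ℝ) - (s + σ) / 4) : ℝ) : ℂ)‖ ^ 2
      = (1 + (n : ℝ) ^ 2) ^ (τ - 1 / 2 - (s + σ) / 2) := fun τ n => by
    rw [hsq, ← Real.rpow_add (weight_pos n)]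
    ring_nf
  have hmem : MemH s fun n : ℤ => (((1 + (n : ℝ) ^ 2) ^ (-(1 / 4 : ℝ) - (s + σ) / 4) : ℝ) : ℂ) :=
    (summable_weight (a := s - 1 / 2 - (s + σ) / 2) (by linarith)).congr fun n => (hτ s n).symm
  let v : Sobolev s := ⟨_, hmem, fun n => by simp⟩
  refine ⟨(v, 0), fun hv => ?_⟩
  have h1 : Summable fun n : ℤ => (1 + (n : ℝ) ^ 2) ^ (σ - 1 / 2 - (s + σ) / 2) :=
    hv.1.congr fun n => hτ σ n
  have h2 : Summable fun n : ℕ => (1 + ((n : ℤ) : ℝ) ^ 2) ^ (σ - 1 / 2 - (s + σ) / 2) :=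
    h1.comp_injective Nat.cast_injective
  have h3 : Summable fun n : ℕ => (1 + (((n + 1 : ℕ) : ℤ) : ℝ) ^ 2) ^ (σ - 1 / 2 - (s + σ) / 2) :=
    (summable_nat_add_iff 1).2 h2
  refine Real.not_summable_one_div_natCast ?_
  rw [← summable_nat_add_iff 1]
  -- The factor `2` comes from `1 + x² ≤ (2x)²` for `x = n + 1 ≥ 1`.
  refine (h3.mul_left 2).of_nonneg_of_le (fun n => by positivity) fun n => ?_
  have hb : (1 : ℝ) ≤ ((n + 1 : ℕ) : ℝ) := by exact_mod_cast Nat.succ_le_succ (Nat.zero_le n)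
  push_cast at hb ⊢
  set x : ℝ := (n : ℝ) + 1 with hx
  have h4 : (1 + x ^ 2) ^ (-(1 / 2) : ℝ) ≤ (1 + x ^ 2) ^ (σ - 1 / 2 - (s + σ) / 2) :=
    Real.rpow_le_rpow_of_exponent_le (by nlinarith) (by linarith)
  have h5 : (2 * x) ^ (-1 : ℝ) ≤ (1 + x ^ 2) ^ (-(1 / 2) : ℝ) := by
    have h6 : (2 * x) ^ (-1 : ℝ) = ((2 * x) ^ 2) ^ (-(1 / 2) : ℝ) := by
      rw [← Real.rpow_natCast, ← Real.rpow_mul (by positivity)]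
      norm_num
    rw [h6]
    exact Real.rpow_le_rpow_of_nonpos (by positivity) (by nlinarith) (by norm_num)
  rw [Real.rpow_neg_one, mul_inv] at h5
  rw [one_div]
  linarith

/-- A function which is `1` at the origin and vanishes on a punctured line is not continuous. -/
theorem not_continuous_of_smul {E : Type*} [AddCommGroup E] [Module ℝ E] [TopologicalSpace E]
    [ContinuousSMul ℝ E] {F : E → ℝ} (u : E) (h0 : F 0 = 1) (h : ∀ c : ℝ, c ≠ 0 → F (c • u) = 0) :
    ¬ Continuous F := by
  intro hF
  have h1 : Continuous fun c : ℝ => F (c • u) := hF.comp (continuous_id.smul continuous_const)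
  have h2 : Tendsto (fun c : ℝ => F (c • u)) (𝓝[≠] 0) (𝓝 1) := by
    have := (h1.tendsto 0).mono_left (nhdsWithin_le_nhds (s := {0}ᶜ))
    rwa [zero_smul, h0] at this
  have h3 : Tendsto (fun c : ℝ => F (c • u)) (𝓝[≠] 0) (𝓝 0) :=
    tendsto_const_nhds.congr' (by
      filter_upwards [self_mem_nhdsWithin] with c hc
      exact (h c hc).symm)
  exact one_ne_zero (tendsto_nhds_unique h2 h3)

theorem not_continuous_indicatorPhase {s σ : ℝ} (h : s < σ) :
    ¬ Continuous (indicatorPhase s σ) := by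
  obtain ⟨u, hu⟩ := exists_not_inPhase h
  exact not_continuous_of_smul u (if_pos (inPhase_zero s σ)) fun c hc =>
    if_neg fun hcu => hu ((inPhase_smul_iff hc u).1 hcu)

theorem not_continuous_indicatorPhaseHalfMinus {s : ℝ} (h : s < 1 / 2) :
    ¬ Continuous (indicatorPhaseHalfMinus s) := by
  obtain ⟨σ, hσ, hσ'⟩ := exists_between h
  obtain ⟨u, hu⟩ := exists_not_inPhase hσ
  exact not_continuous_of_smul u (if_pos fun τ _ => inPhase_zero s τ) fun c hc =>
    if_neg fun hcu => hu ((inPhase_smul_iff hc u).1 (hcu σ hσ'))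

theorem indicatorPhase_congr {s σ : ℝ} {u v : Phase s} (h : InPhase σ u ↔ InPhase σ v) :
    indicatorPhase s σ u = indicatorPhase s σ v := by
  by_cases hv : InPhase σ v
  · rw [indicatorPhase, indicatorPhase, if_pos hv, if_pos (h.2 hv)]
  · rw [indicatorPhase, indicatorPhase, if_neg hv, if_neg (h.not.2 hv)]

theorem indicatorPhaseHalfMinus_congr {s : ℝ} {u v : Phase s}
    (h : ∀ σ < (1 / 2 : ℝ), InPhase σ u ↔ InPhase σ v) :
    indicatorPhaseHalfMinus s u = indicatorPhaseHalfMinus s v := by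
  have h' := forall₂_congr h
  by_cases hv : ∀ σ < (1 / 2 : ℝ), InPhase σ v
  · rw [indicatorPhaseHalfMinus, indicatorPhaseHalfMinus, if_pos hv, if_pos (h'.2 hv)]
  · rw [indicatorPhaseHalfMinus, indicatorPhaseHalfMinus, if_neg hv, if_neg (h'.not.2 hv)]

theorem abs_indicatorPhaseHalfMinus_le (s : ℝ) (u : Phase s) :
    |indicatorPhaseHalfMinus s u| ≤ 1 := by
  unfold indicatorPhaseHalfMinus
  split_ifs <;> simp

/-- An observable which is almost surely conserved is a fixed point of the transition operator. -/
theorem transition_eq_of_ae_eq {Ω : Type*} [MeasurableSpace Ω] {P : Measure Ω}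
    [IsProbabilityMeasure P] {W : ℤ → ℝ≥0 → Ω → ℂ} {γ β s : ℝ} {F : Phase s → ℝ} {u₀ : Phase s}
    {t : ℝ≥0} (h : ∀ᵐ ω ∂P, F (flow γ β s (fun n r => W n r ω) u₀ t) = F u₀) :
    Integrable (fun ω => F (flow γ β s (fun n r => W n r ω) u₀ t)) P ∧
      transition P W γ β s t F u₀ = F u₀ := by
  -- The integrand agrees almost surely with a constant, so measurability of the flow in `ω` is not
  -- required.
  refine ⟨(integrable_const (F u₀)).congr (h.mono fun _ hω => hω.symm), ?_⟩
  rw [transition, integral_congr_ae h]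
  simp

end SineGordon

/-! ### The main theorem -/

open SineGordon in
theorem proposition3p1 {Ω : Type*} [MeasurableSpace Ω] (P : Measure Ω) [IsProbabilityMeasure P]
    (W : ℤ → ℝ≥0 → Ω → ℂ) (hW : IsCylindricalWiener W P)
    (γ β : ℝ) (hγ : γ ≠ 0) (hβ : β ≠ 0) (s : ℝ) (hs : 0 ≤ s) (hs' : s < 1 / 2) :
    -- the flow is well defined
    (∀ᵐ ω ∂P, ∀ u₀ : Phase s, ∃! Φ : C(ℝ≥0, Phase s),
      IsMildSolution γ β (fun n r => W n r ω) u₀ Φ) ∧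
    -- the indicator functions are fixed by the semigroup and discontinuous
    (∀ F : Phase s → ℝ,
      ((∃ σ : ℝ, s < σ ∧ σ < 1 / 2 ∧ F = indicatorPhase s σ) ∨ F = indicatorPhaseHalfMinus s) →
      Measurable F ∧
      ∀ t : ℝ≥0,
        (∀ u₀ : Phase s,
          Integrable (fun ω => F (flow γ β s (fun n r => W n r ω) u₀ t)) P ∧
          transition P W γ β s t F u₀ = F u₀) ∧
        ¬ Continuous (transition P W γ β s t F)) ∧
    -- failure of the strong Feller property
    (∀ t : ℝ≥0, ¬ IsStrongFeller (transition P W γ β s t)) := by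
  have hreg := hW.ae_isRegularNoise
  have hfix : ∀ F : Phase s → ℝ,
      ((∃ σ : ℝ, s < σ ∧ σ < 1 / 2 ∧ F = indicatorPhase s σ) ∨ F = indicatorPhaseHalfMinus s) →
      Measurable F ∧
      ∀ t : ℝ≥0,
        (∀ u₀ : Phase s,
          Integrable (fun ω => F (flow γ β s (fun n r => W n r ω) u₀ t)) P ∧
          transition P W γ β s t F u₀ = F u₀) ∧
        ¬ Continuous (transition P W γ β s t F) := by
    rintro F (⟨σ, hsσ, hσ, rfl⟩ | rfl)
    · have h : ∀ t u₀, _ := fun (t : ℝ≥0) (u₀ : Phase s) =>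
        transition_eq_of_ae_eq (P := P) (W := W) (γ := γ) (β := β) (F := indicatorPhase s σ)
          (u₀ := u₀) (t := t) (by
            filter_upwards [hreg] with ω hω
            exact indicatorPhase_congr (hω.inPhase_flow_iff hs hs' γ β u₀ hσ t))
      refine ⟨measurable_indicatorPhase s σ, fun t => ⟨h t, ?_⟩⟩
      -- The transition operator fixes the indicator as a function, so the discontinuity of the
      -- indicator carries over to its image.
      rw [funext fun u₀ => (h t u₀).2]
      exact not_continuous_indicatorPhase hsσ
    · have h : ∀ t u₀, _ := fun (t : ℝ≥0) (u₀ : Phase s) =>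
        transition_eq_of_ae_eq (P := P) (W := W) (γ := γ) (β := β)
          (F := indicatorPhaseHalfMinus s) (u₀ := u₀) (t := t) (by
            filter_upwards [hreg] with ω hω
            exact indicatorPhaseHalfMinus_congr fun σ hσ =>
              hω.inPhase_flow_iff hs hs' γ β u₀ hσ t)
      refine ⟨measurable_indicatorPhaseHalfMinus s, fun t => ⟨h t, ?_⟩⟩
      rw [funext fun u₀ => (h t u₀).2]
      exact not_continuous_indicatorPhaseHalfMinus hs'
  refine ⟨?_, hfix, fun t hF => ?_⟩
  · filter_upwards [hreg] with ω hω u₀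
    exact hω.existsUnique hs hs' γ β u₀
  -- The indicator of the intersection is a counterexample that requires no choice of `σ`.
  · obtain ⟨hm, ht⟩ := hfix _ (Or.inr rfl)
    exact (ht t).2 (hF _ hm ⟨1, abs_indicatorPhaseHalfMinus_le s⟩)
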